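/- Let $D$ be a finitely generated abelian group and let $S=\bigoplus_{d\in D}S_d$ be a $D$-graded integral domain. Assume that $S$ is effectively graded, i.e. $D$ is generated by $\{d\in D\mid S_d\neq 0\}$, and factorially $D$-graded: every nonzero homogeneous nonunit is a product of $D$-prime elements, where a homogeneous nonzero nonunit $f$ is $D$-prime if, for all homogeneous $g,h$, $f\mid gh$ implies $f\mid g$ or $f\mid h$. A homogeneous $f\in S$ is relevant if the degrees of the homogeneous units of $S_f$ form a subgroup of finite index in $D$; let $S_+$ be the ideal generated by all relevant elements. Let $(S,B)$ be a conical ring, i.e. $B\subseteq S_+$ is a graded ideal of $S$. A proper graded ideal $\mathfrak p$ of $S$ is $D$-prime if, for all homogeneous $f,g$, $fg\in\mathfrak p$ implies $f\in\mathfrak p$ or $g\in\mathfrak p$. Let $$\operatorname{Proj}_D^B(S)=\{\mathfrak p\mid \mathfrak p\text{ is a }D\text{-prime ideal of }S,\ B\not\subseteq\mathfrak p\},$$ with the homogeneous Zariski topology, whose closed sets are the sets $\{\mathfrak p\mid E\subseteq\mathfrak p\}$ for sets $E$ of homogeneous elements of $S$. For relevant $f\in B$ let $D_+(f)=\{\mathfrak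 p\in\operatorname{Proj}_D^B(S)\mid f\notin\mathfrak p\}$, let $S_{(f)}$ be the degree-zero part of $S_f$, and let $\psi_f\colon D_+(f)\to\operatorname{Spec}(S_{(f)})$, $\mathfrak p\mapsto \mathfrak pS_f\cap S_{(f)}$. Finally let $Q(S)$ be the quotient, in the category of ringed spaces, of $\operatorname{Spec}(S)$ by the action of the diagonalizable group scheme $\operatorname{Spec}(S_0[D])$ given by the grading, i.e. the coequalizer of action and projection $\operatorname{Spec}(S[D])\rightrightarrows\operatorname{Spec}(S)$. Let the Brenner–Schröer $\operatorname{Proj}^D_B(S)$ be the open ringed subspace $\bigcup_{f}\operatorname{Spec}(S_{(f)})$ of $Q(S)$, the union over all relevant $f\in B$, where $\operatorname{Spec}(S_{(f)})$ is the image in $Q(S)$ of the open set $\{\mathfrak q\mid f\notin\mathfrak q\}$ of $\operatorname{Spec}(S)$. Then the sets $D_+(f)$, $f\in B$ relevant, form an open covering of $\operatorname{Proj}_D^B(S)$, and each $\psi_f$ is a homeomorphism. Moreover $\operatorname{Proj}_D^B(S)$ carries the structure of a scheme such that the $D_+(f)$ are affine open subschemes, each $\psi_f$ is the map of spaces underlying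 an isomorphism of schemes $\varphi_f\colon D_+(f)\to\operatorname{Spec}(S_{(f)})$, these isomorphisms are compatible with the canonical maps $S_{(f)}\to S_{(fg)}$ (for $g$ homogeneous), and there is an isomorphism of ringed spaces $\theta\colon\operatorname{Proj}_D^B(S)\to\operatorname{Proj}^D_B(S)$ (so that $\operatorname{Proj}^D_B(S)$ is a scheme and $\theta$ an isomorphism of schemes). The isomorphism $\theta$ is canonical: for each relevant $f\in B$ the composite $\operatorname{Spec}(S_f)\to\operatorname{Spec}(S_{(f)})\xrightarrow{\varphi_f^{-1}}D_+(f)\subseteq\operatorname{Proj}_D^B(S)\xrightarrow{\theta}\operatorname{Proj}^D_B(S)\subseteq Q(S)$ is the composite $\operatorname{Spec}(S_f)\to\operatorname{Spec}(S)\to Q(S)$. -/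

import Mathlib

open CategoryTheory AlgebraicGeometry TopologicalSpace

universe u

noncomputable section

namespace MultigradedProj

/-! ### Graded notions: effective, periodic, factorially graded, relevant -/

section Grading

variable {D : Type u} [AddCommGroup D] {S : Type u} [CommRing S]

/-- The grading group is generated by the support `{d | S_d ≠ 0}`. -/
def IsEffective (𝒜 : D → AddSubgroup S) : Prop :=
  AddSubgroup.closure {d : D | 𝒜 d ≠ ⊥} = ⊤

/-- The degrees of the homogeneous units form a subgroup of finite index in the grading group. -/
def IsPeriodic (𝒜 : D → AddSubgroup S) : Prop :=
  ∃ H : AddSubgroup D, H.FiniteIndex ∧ ∀ d : D, d ∈ H ↔ ∃ u : Sˣ, (u : S) ∈ 𝒜 d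

/-- A `D`-prime element: a homogeneous nonzero nonunit which is prime with respect to
homogeneous factors. -/
structure IsDPrimeElement (𝒜 : D → AddSubgroup S) (f : S) : Prop where
  homogeneous : SetLike.IsHomogeneousElem 𝒜 f
  ne_zero : f ≠ 0
  not_isUnit : ¬ IsUnit f
  dvd_or_dvd : ∀ g h : S, SetLike.IsHomogeneousElem 𝒜 g → SetLike.IsHomogeneousElem 𝒜 h →
    f ∣ g * h → f ∣ g ∨ f ∣ h

/-- Every homogeneous nonzero nonunit is a product of `D`-prime elements. -/
def IsFactoriallyGraded (𝒜 : D → AddSubgroup S) : Prop :=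
  ∀ f : S, SetLike.IsHomogeneousElem 𝒜 f → f ≠ 0 → ¬ IsUnit f →
    ∃ s : Multiset S, (∀ q ∈ s, IsDPrimeElement 𝒜 q) ∧ s.prod = f

variable [DecidableEq D] (𝒜 : D → AddSubgroup S) [GradedRing 𝒜]

/-- The induced grading of a localization of `S`: the part of degree `d` consists of the
fractions `a / s` with `a` and `s` homogeneous and `deg a - deg s = d`. -/
def locGrading (M : Submonoid S) (d : D) : AddSubgroup (Localization M) where
  carrier := {x | ∃ (i j : D) (a : S) (s : M), a ∈ 𝒜 i ∧ (s : S) ∈ 𝒜 j ∧ i - j = d ∧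
    x = Localization.mk a s}
  zero_mem' := ⟨d, 0, 0, 1, zero_mem _, SetLike.GradedOne.one_mem, sub_zero d,
    (Localization.mk_zero 1).symm⟩
  add_mem' := by
    rintro _ _ ⟨i, j, a, s, ha, hs, hd, rfl⟩ ⟨i', j', a', s', ha', hs', hd', rfl⟩
    refine ⟨j + i', j + j', s * a' + s' * a, s * s', ?_, SetLike.mul_mem_graded hs hs', ?_,
      Localization.add_mk _ _ _ _⟩
    · refine add_mem (SetLike.mul_mem_graded hs ha') ?_
      have h : j + i' = j' + i := by
        rw [← sub_eq_zero] at hd hd' ⊢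
        have : j + i' - (j' + i) = (i' - j' - d) - (i - j - d) := by abel
        rw [this, hd, hd', sub_zero]
      rw [h]
      exact SetLike.mul_mem_graded hs' ha
    · rw [← hd']; abel
  neg_mem' := by
    rintro _ ⟨i, j, a, s, ha, hs, hd, rfl⟩
    exact ⟨i, j, -a, s, neg_mem ha, hs, hd, Localization.neg_mk _ _⟩

/-- `f` is relevant: it is homogeneous and the graded ring `S_f` is periodic. -/
def IsRelevant (f : S) : Prop :=
  SetLike.IsHomogeneousElem 𝒜 f ∧ IsPeriodic (locGrading 𝒜 (Submonoid.powers f))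

/-- The irrelevant ideal `S_+`, generated by all relevant elements. -/
def irrelevantIdeal : Ideal S := Ideal.span {f | IsRelevant 𝒜 f}

/-- `(S, B)` is a conical ring: `B` is a graded ideal contained in the irrelevant ideal. -/
structure IsConical (B : Ideal S) : Prop where
  homogeneous : B.IsHomogeneous 𝒜
  le_irrelevant : B ≤ irrelevantIdeal 𝒜

/-- The relevant elements of `S` that belong to `B`. -/
def Rel (B : Ideal S) : Type u := {f : S // f ∈ B ∧ IsRelevant 𝒜 f}

end Grading

/-! ### The multihomogeneous `D`-prime spectrum -/

section DPrimeSpectrum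

variable {D : Type u} [AddCommGroup D] [DecidableEq D] {S : Type u} [CommRing S]
  (𝒜 : D → AddSubgroup S) [GradedRing 𝒜]

/-- A `D`-prime ideal: a proper graded ideal which is prime with respect to homogeneous
elements. -/
structure IsDPrime (p : Ideal S) : Prop where
  homogeneous : p.IsHomogeneous 𝒜
  ne_top : p ≠ ⊤
  mem_or_mem : ∀ f g : S, SetLike.IsHomogeneousElem 𝒜 f → SetLike.IsHomogeneousElem 𝒜 g →
    f * g ∈ p → f ∈ p ∨ g ∈ p

/-- The multihomogeneous `D`-prime spectrum of `(S, B)`: all `D`-prime ideals that do not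
contain `B`. -/
def ProjD (B : Ideal S) : Type u := {p : Ideal S // IsDPrime 𝒜 p ∧ ¬ B ≤ p}

variable {B : Ideal S}

/-- The closed set `V_+(E)` of the `D`-prime ideals (not containing `B`) that contain `E`. -/
def zeroLocus (B : Ideal S) (E : Set S) : Set (ProjD 𝒜 B) := {p | E ⊆ p.1}

/-- The homogeneous Zariski topology: the closed sets are the `V_+(E)` for `E` a set of
homogeneous elements. -/
instance : TopologicalSpace (ProjD 𝒜 B) :=
  TopologicalSpace.ofClosed
    {Z | ∃ E : Set S, (∀ f ∈ E, SetLike.IsHomogeneousElem 𝒜 f) ∧ Z = zeroLocus 𝒜 B E}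
    (by
      refine ⟨{1}, ?_, ?_⟩
      · rintro f rfl
        exact ⟨0, SetLike.GradedOne.one_mem⟩
      · ext p
        simp only [zeroLocus, Set.mem_empty_iff_false, Set.mem_ofPred_eq, false_iff,
          Set.singleton_subset_iff, SetLike.mem_coe]
        exact fun h => p.2.1.ne_top ((Ideal.eq_top_iff_one _).2 h))
    (by
      intro A hA
      refine ⟨⋃₀ {E | (∀ f ∈ E, SetLike.IsHomogeneousElem 𝒜 f) ∧ zeroLocus 𝒜 B E ∈ A}, ?_, ?_⟩
      · rintro f ⟨E, hE, hf⟩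
        exact hE.1 f hf
      · ext p
        simp only [zeroLocus, Set.mem_sInter, Set.mem_ofPred_eq, Set.sUnion_subset_iff]
        constructor
        · rintro h E ⟨_, hE⟩
          exact h _ hE
        · intro h Z hZ
          obtain ⟨E, hE, rfl⟩ := hA hZ
          exact h E ⟨hE, hZ⟩)
    (by
      rintro _ ⟨E, hE, rfl⟩ _ ⟨E', hE', rfl⟩
      refine ⟨{x | ∃ f ∈ E, ∃ g ∈ E', x = f * g}, ?_, ?_⟩
      · rintro _ ⟨f, hf, g, hg, rfl⟩
        obtain ⟨i, hi⟩ := hE f hf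
        obtain ⟨j, hj⟩ := hE' g hg
        exact ⟨i + j, SetLike.mul_mem_graded hi hj⟩
      · ext p
        constructor
        · rintro (h | h) _ ⟨f, hf, g, hg, rfl⟩
          · exact p.1.mul_mem_right g (h hf)
          · exact p.1.mul_mem_left f (h hg)
        · intro h
          by_contra hcon
          obtain ⟨h1, h2⟩ := not_or.1 hcon
          obtain ⟨f, hf, hfp⟩ := Set.not_subset.1 h1
          obtain ⟨g, hg, hgp⟩ := Set.not_subset.1 h2
          rcases p.2.1.mem_or_mem f g (hE f hf) (hE' g hg) (h ⟨f, hf, g, hg, rfl⟩) with h | h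
          · exact hfp h
          · exact hgp h)

/-- The set `D_+(f)` of the `D`-prime ideals (not containing `B`) that do not contain `f`. -/
def basicOpen (B : Ideal S) (f : S) : Set (ProjD 𝒜 B) := {p | f ∉ p.1}

lemma isOpen_basicOpen (B : Ideal S) {f : S} (hf : SetLike.IsHomogeneousElem 𝒜 f) :
    IsOpen (basicOpen 𝒜 B f) := by
  refine ⟨{f}, ?_, ?_⟩
  · rintro _ rfl
    exact hf
  · ext p
    simp [basicOpen, zeroLocus]

/-- The contraction `pS_f ∩ S_(f)` of a `D`-prime ideal `p` not containing `f`. -/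
def contraction (f : S) (p : Ideal S) : Ideal (HomogeneousLocalization.Away 𝒜 f) :=
  (p.map (algebraMap S (Localization.Away f))).comap
    (algebraMap (HomogeneousLocalization.Away 𝒜 f) (Localization.Away f))

lemma contraction_isPrime {f : S} (hf : SetLike.IsHomogeneousElem 𝒜 f) {p : Ideal S}
    (hp : IsDPrime 𝒜 p) (hfp : f ∉ p) : (contraction 𝒜 f p).IsPrime := by
  have hpow : ∀ n : ℕ, SetLike.IsHomogeneousElem 𝒜 (f ^ n) := by
    obtain ⟨d, hd⟩ := hf
    exact fun n => ⟨n • d, SetLike.pow_mem_graded n hd⟩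
  have hpow' : ∀ n : ℕ, f ^ n ∉ p := by
    intro n
    induction n with
    | zero => simpa using (Ideal.ne_top_iff_one _).1 hp.ne_top
    | succ n ih =>
      rw [pow_succ]
      intro h
      exact (hp.mem_or_mem _ _ (hpow n) hf h).elim ih hfp
  have key : ∀ x : HomogeneousLocalization.NumDenSameDeg 𝒜 (Submonoid.powers f),
      HomogeneousLocalization.mk x ∈ contraction 𝒜 f p ↔ (x.num : S) ∈ p := by
    intro x
    rw [contraction, Ideal.mem_comap, HomogeneousLocalization.algebraMap_apply,
      HomogeneousLocalization.val_mk, Localization.mk_eq_mk',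
      IsLocalization.mk'_mem_map_algebraMap_iff]
    constructor
    · rintro ⟨_, ⟨n, rfl⟩, h⟩
      exact (hp.mem_or_mem _ _ (hpow n) ⟨_, x.num.2⟩ h).resolve_left (hpow' n)
    · intro h
      exact ⟨1, one_mem _, by simpa using h⟩
  refine ⟨?_, ?_⟩
  · rw [Ideal.ne_top_iff_one]
    intro h
    exact (Ideal.ne_top_iff_one _).1 hp.ne_top ((key 1).1 h)
  · intro x y h
    obtain ⟨x, rfl⟩ := HomogeneousLocalization.mk_surjective x
    obtain ⟨y, rfl⟩ := HomogeneousLocalization.mk_surjective y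
    rw [key, key]
    have h' := (key (x * y)).1 h
    exact hp.mem_or_mem _ _ ⟨_, x.num.2⟩ ⟨_, y.num.2⟩ h'

/-- The map `ψ_f : D_+(f) → Spec S_(f)`, `p ↦ pS_f ∩ S_(f)`, for a relevant `f ∈ B`. -/
def psi (f : Rel 𝒜 B) (p : basicOpen 𝒜 B f.1) :
    Spec (CommRingCat.of (HomogeneousLocalization.Away 𝒜 f.1)) :=
  (⟨contraction 𝒜 f.1 p.1.1, contraction_isPrime 𝒜 f.2.2.1 p.1.2.1 p.2⟩ :
    PrimeSpectrum (HomogeneousLocalization.Away 𝒜 f.1))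

end DPrimeSpectrum

/-! ### The Brenner–Schröer multigraded Proj -/

section BrennerSchroer

variable {D : Type u} [AddCommGroup D] [DecidableEq D] {S : Type u} [CommRing S]
  (𝒜 : D → AddSubgroup S) [GradedRing 𝒜]

/-- The coaction `S → S[D]` of the grading, sending `s` of degree `d` to `s χ^d`. -/
def coaction : S →+* AddMonoidAlgebra S D :=
  (DirectSum.toSemiring
    (fun d => (AddMonoidAlgebra.singleAddHom d).comp (𝒜 d).subtype)
    rfl
    (fun a b => by simp [AddMonoidAlgebra.single_mul_single])).comp
    (DirectSum.decomposeRingEquiv 𝒜).toRingHom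

lemma coaction_of_mem {d : D} {s : S} (hs : s ∈ 𝒜 d) :
    coaction 𝒜 s = AddMonoidAlgebra.single d s := by
  have h : DirectSum.decomposeRingEquiv 𝒜 s = DirectSum.of (fun i => 𝒜 i) d ⟨s, hs⟩ :=
    DirectSum.decompose_of_mem 𝒜 hs
  rw [coaction, RingHom.comp_apply]
  change DirectSum.toSemiring _ _ _ (DirectSum.decomposeRingEquiv 𝒜 s) = _
  rw [h]
  exact DirectSum.toSemiring_of _ _ _ _ _

/-- The action `G × Spec S = Spec S[D] → Spec S` of the diagonalizable group scheme
`G = Spec S_0[D]` (over `S_0`). -/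
def actionMap : Spec (CommRingCat.of (AddMonoidAlgebra S D)) ⟶ Spec (CommRingCat.of S) :=
  Spec.map (CommRingCat.ofHom (coaction 𝒜))

variable (D S) in
/-- The projection `G × Spec S = Spec S[D] → Spec S`. -/
def projectionMap : Spec (CommRingCat.of (AddMonoidAlgebra S D)) ⟶ Spec (CommRingCat.of S) :=
  Spec.map (CommRingCat.ofHom AddMonoidAlgebra.singleZeroRingHom)

/-- The quotient `Q(S)` of `Spec S` by the action of `G`, in the category of ringed spaces. -/
def Q : RingedSpace.{u} :=
  Limits.coequalizer (C := SheafedSpace CommRingCat.{u})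
    (actionMap 𝒜).toLRSHom.toShHom (projectionMap D S).toLRSHom.toShHom

/-- The quotient morphism `Spec S → Q(S)` of ringed spaces. -/
def quotientMap : (Spec (CommRingCat.of S)).toSheafedSpace ⟶ Q 𝒜 :=
  Limits.coequalizer.π (C := SheafedSpace CommRingCat.{u})
    (actionMap 𝒜).toLRSHom.toShHom (projectionMap D S).toLRSHom.toShHom

lemma preimage_action_eq (f : S) (hf : SetLike.IsHomogeneousElem 𝒜 f) :
    (actionMap 𝒜) ⁻¹ᵁ (PrimeSpectrum.basicOpen f) =
      (projectionMap D S) ⁻¹ᵁ (PrimeSpectrum.basicOpen f) := by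
  obtain ⟨d, hd⟩ := hf
  have h : coaction 𝒜 f = AddMonoidAlgebra.singleZeroRingHom f * AddMonoidAlgebra.single d 1 := by
    rw [coaction_of_mem 𝒜 hd]
    simp [AddMonoidAlgebra.single_mul_single]
  have hu : IsUnit (AddMonoidAlgebra.single d (1 : S)) :=
    IsUnit.of_mul_eq_one (AddMonoidAlgebra.single (-d) 1)
      (by simp [AddMonoidAlgebra.single_mul_single, AddMonoidAlgebra.one_def])
  ext x
  change coaction 𝒜 f ∉ PrimeSpectrum.asIdeal x ↔
    AddMonoidAlgebra.singleZeroRingHom f ∉ PrimeSpectrum.asIdeal x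
  rw [h, Ideal.mul_unit_mem_iff_mem _ hu]

/-- The image in `Q(S)` of the principal open set `D(f)` of `Spec S`. -/
def imageBasicOpen (f : S) : Set (Q 𝒜) :=
  (quotientMap 𝒜).hom.base '' {x : PrimeSpectrum S | f ∉ x.asIdeal}

lemma isOpen_imageBasicOpen {f : S} (hf : SetLike.IsHomogeneousElem 𝒜 f) :
    IsOpen (imageBasicOpen 𝒜 f) := by
  have hc := Limits.isColimitCoforkMapOfIsColimit (SheafedSpace.forget CommRingCat.{u}) _
    (Limits.coequalizerIsCoequalizer (C := SheafedSpace CommRingCat.{u})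
      (actionMap 𝒜).toLRSHom.toShHom (projectionMap D S).toLRSHom.toShHom)
  have hpre : (quotientMap 𝒜).hom.base ⁻¹' (imageBasicOpen 𝒜 f) =
      {x : PrimeSpectrum S | f ∉ x.asIdeal} := by
    fapply Limits.Types.coequalizer_preimage_image_eq_of_preimage_eq
      (↾(actionMap 𝒜).toLRSHom.base) (↾(projectionMap D S).toLRSHom.base)
      (↾(quotientMap 𝒜).hom.base)
    · ext x
      have h := congrArg (fun t => t.hom.base)
        (Limits.coequalizer.condition (C := SheafedSpace CommRingCat.{u})
          (actionMap 𝒜).toLRSHom.toShHom (projectionMap D S).toLRSHom.toShHom)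
      exact ConcreteCategory.congr_hom h x
    · exact Limits.isColimitCoforkMapOfIsColimit (CategoryTheory.forget TopCat) _ hc
    · exact congrArg (fun U : Opens _ => U.carrier) (preimage_action_eq 𝒜 f hf)
  refine (TopCat.isOpen_iff_of_isColimit_cofork _ hc _).2 ?_
  change IsOpen ((quotientMap 𝒜).hom.base ⁻¹' (imageBasicOpen 𝒜 f))
  rw [hpre]
  exact (PrimeSpectrum.basicOpen f).2

/-- The open subset of `Q(S)` that is the union of the images of the `D(f)`, `f ∈ B` relevant.
(The image of `D(f)` is the open subspace `Spec S_(f)` of `Q(S)`.) -/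
def relevantLocus (B : Ideal S) : Opens (Q 𝒜) :=
  ⟨⋃ f : Rel 𝒜 B, imageBasicOpen 𝒜 f.1,
    isOpen_iUnion fun f => isOpen_imageBasicOpen 𝒜 f.2.2.1⟩

/-- The Brenner–Schröer `Proj^D_B(S)`, an open subspace of the ringed space `Q(S)`. -/
def BSProj (B : Ideal S) : RingedSpace.{u} :=
  SheafedSpace.restrict (Q 𝒜) (relevantLocus 𝒜 B).isOpenEmbedding

/-- The inclusion of `Proj^D_B(S)` into `Q(S)`. -/
def BSProjInclusion (B : Ideal S) : BSProj 𝒜 B ⟶ Q 𝒜 :=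
  SheafedSpace.ofRestrict (Q 𝒜) (relevantLocus 𝒜 B).isOpenEmbedding

end BrennerSchroer

/-! ### Charts -/

section Charts

variable {D : Type u} [AddCommGroup D] [DecidableEq D] {S : Type u} [CommRing S]
  (𝒜 : D → AddSubgroup S) [GradedRing 𝒜] {B : Ideal S}

/-- For a scheme `X` with underlying space `Proj_D^B(S)` (through `e`), the open subset
`D_+(f)` of `X`. -/
def chart {X : Scheme.{u}} (e : X ≃ₜ ProjD 𝒜 B) (f : Rel 𝒜 B) : X.Opens :=
  ⟨e ⁻¹' basicOpen 𝒜 B f.1, (isOpen_basicOpen 𝒜 B f.2.2.1).preimage e.continuous⟩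

/-- The affine scheme `Spec S_(f)`. -/
abbrev specAway (f : S) : Scheme.{u} :=
  Spec (CommRingCat.of (HomogeneousLocalization.Away 𝒜 f))

/-- The morphism `Spec S_(h) → Spec S_(f)` given by `S_(f) → S_(h)`, for `h = f g` with `g`
homogeneous. -/
def specAwayMap {d : D} {f g h : S} (hg : g ∈ 𝒜 d) (hh : h = f * g) :
    specAway 𝒜 h ⟶ specAway 𝒜 f :=
  Spec.map (CommRingCat.ofHom (HomogeneousLocalization.awayMap 𝒜 hg hh))

/-- The morphism `Spec S_f → Spec S_(f)` given by the inclusion `S_(f) → S_f`. -/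
def specToSpecAway (f : S) : Spec (CommRingCat.of (Localization.Away f)) ⟶ specAway 𝒜 f :=
  Spec.map (CommRingCat.ofHom
    (algebraMap (HomogeneousLocalization.Away 𝒜 f) (Localization.Away f)))

/-- The composite `Spec S_f → Spec S → Q(S)`. -/
def specToQ (f : S) :
    (Spec (CommRingCat.of (Localization.Away f))).toSheafedSpace ⟶ Q 𝒜 :=
  (Spec.map (CommRingCat.ofHom (algebraMap S (Localization.Away f)))).toLRSHom.toShHom ≫
    quotientMap 𝒜

end Charts

end MultigradedProj

end

/-! A point of the relevant locus of `Q(S)` is the class of a prime P of S, and `toProjD` sends it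
to the homogeneous core of P. This is a homeomorphism onto `ProjD 𝒜 B`, and the image of each D(f)
in `Q(S)` is Spec S_(f). The scheme X is therefore the relevant locus itself, read through this
homeomorphism, and θ is the identity.

Relevance enters through `IsRelevant.exists_dvd_pow`: for f of degree m and any degree d, some
positive multiple e d has a homogeneous c of degree n m - e d dividing a power of f. For a of degree
d and a D-prime p avoiding f, a lies in p exactly when a^e c / f^n lies in the contraction of p to
S_(f). So p is determined by its contraction, and closed sets correspond. Conversely S_(f) is a
direct summand of S_f, so primes of S_(f) lift to S_f (`comap_map_away`) and their cores give
surjectivity of ψ_f. Homogeneous multiples of relevant elements are relevant, which yields the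
covering.

A D-prime ideal need not be prime, but it is the core of a prime, found by avoiding the homogeneous
elements outside it; hence `toProjD` is onto. For injectivity let P and P' have the same homogeneous
elements and miss a relevant f. Their residue points have the same kernel on S_(f), so they agree
there after passing to a common algebraically closed field k. On all of S they then differ by a
character of D with values in kˣ: relevance makes the ratios consistent, and divisibility of kˣ
extends them to D. The character defines a point of Spec S[D] over both primes (`exists_orbit`). The
map is closed by a going-down argument (`IsDPrime.exists_isPrime_le`).

Sections of `Q(S)` over an open set are the sections on Spec S on which action and projection agree.
Over D(f) these are the fractions of degree zero, by comparing coefficients in S[D]. The resulting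
morphism from the image of D(f) to Spec S_(f) has underlying map ψ_f after `toProjD`, and it is
bijective on sections over principal opens, hence an isomorphism. -/

namespace MultigradedProj

/-! ### D-prime ideals and homogeneous cores of primes -/

section Algebra

variable {D : Type u} [AddCommGroup D] [DecidableEq D] {S : Type u} [CommRing S]
  (𝒜 : D → AddSubgroup S) [GradedRing 𝒜]

lemma isHomogeneousElem_mul {a b : S} (ha : SetLike.IsHomogeneousElem 𝒜 a)
    (hb : SetLike.IsHomogeneousElem 𝒜 b) : SetLike.IsHomogeneousElem 𝒜 (a * b) :=
  SetLike.IsHomogeneousElem.mul ha hb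

lemma le_of_isHomogeneous {p q : Ideal S} (hp : p.IsHomogeneous 𝒜)
    (h : ∀ a, SetLike.IsHomogeneousElem 𝒜 a → a ∈ p → a ∈ q) : p ≤ q := by
  intro a ha
  classical
  rw [← DirectSum.sum_support_decompose 𝒜 a]
  exact sum_mem fun i _ => h _ ⟨i, SetLike.coe_mem _⟩ (hp i ha)

lemma mem_core_iff {P : Ideal S} {a : S} (ha : SetLike.IsHomogeneousElem 𝒜 a) :
    a ∈ (P.homogeneousCore 𝒜).toIdeal ↔ a ∈ P :=
  ⟨fun h => Ideal.toIdeal_homogeneousCore_le 𝒜 P h,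
    fun h => Ideal.mem_homogeneousCore_of_homogeneous_of_mem ha h⟩

lemma isDPrime_core (P : Ideal S) [hP : P.IsPrime] :
    IsDPrime 𝒜 (P.homogeneousCore 𝒜).toIdeal where
  homogeneous := HomogeneousIdeal.isHomogeneous _
  ne_top h := hP.ne_top (top_le_iff.1 (h ▸ Ideal.toIdeal_homogeneousCore_le 𝒜 P))
  mem_or_mem f g hf hg h := by
    rw [mem_core_iff 𝒜 hf, mem_core_iff 𝒜 hg]
    exact hP.mem_or_mem (Ideal.toIdeal_homogeneousCore_le 𝒜 P h)

variable {𝒜}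

lemma IsDPrime.one_notMem {p : Ideal S} (hp : IsDPrime 𝒜 p) : (1 : S) ∉ p :=
  (Ideal.ne_top_iff_one _).1 hp.ne_top

/-- The component of ab in degree i + j is a times the component of b in degree j, so only one
factor has to be homogeneous. This is what allows a D-prime ideal to be separated from products with
arbitrary second factor. -/
lemma IsDPrime.mem_or_mem_of_mul {p : Ideal S} (hp : IsDPrime 𝒜 p) {a b : S}
    (ha : SetLike.IsHomogeneousElem 𝒜 a) (hab : a * b ∈ p) : a ∈ p ∨ b ∈ p := by
  obtain ⟨i, hi⟩ := ha
  refine or_iff_not_imp_left.2 fun hap => ?_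
  classical
  rw [← DirectSum.sum_support_decompose 𝒜 b]
  refine sum_mem fun j _ => ?_
  have h := hp.homogeneous (i + j) hab
  rw [DirectSum.coe_decompose_mul_add_of_left_mem 𝒜 hi] at h
  exact (hp.mem_or_mem _ _ ⟨i, hi⟩ ⟨j, SetLike.coe_mem _⟩ h).resolve_left hap

lemma IsDPrime.pow_notMem {p : Ideal S} (hp : IsDPrime 𝒜 p) {a : S}
    (ha : SetLike.IsHomogeneousElem 𝒜 a) (h : a ∉ p) (n : ℕ) : a ^ n ∉ p := by
  induction n with
  | zero => simpa using hp.one_notMem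
  | succ n ih =>
    rw [pow_succ']
    exact fun h' => (hp.mem_or_mem_of_mul ha h').elim h ih

/-- The homogeneous elements outside a `D`-prime ideal. -/
def IsDPrime.homogeneousCompl {p : Ideal S} (hp : IsDPrime 𝒜 p) : Submonoid S where
  carrier := {a | SetLike.IsHomogeneousElem 𝒜 a ∧ a ∉ p}
  one_mem' := ⟨⟨0, SetLike.GradedOne.one_mem⟩, hp.one_notMem⟩
  mul_mem' ha hb := ⟨isHomogeneousElem_mul 𝒜 ha.1 hb.1, fun h =>
    (hp.mem_or_mem _ _ ha.1 hb.1 h).elim ha.2 hb.2⟩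

lemma IsDPrime.core_eq {p P : Ideal S} (hp : IsDPrime 𝒜 p) (hpP : p ≤ P)
    (h : ∀ a, SetLike.IsHomogeneousElem 𝒜 a → a ∈ P → a ∈ p) :
    (P.homogeneousCore 𝒜).toIdeal = p :=
  le_antisymm
    (le_of_isHomogeneous 𝒜 (HomogeneousIdeal.isHomogeneous _)
      fun a ha haP => h a ha ((mem_core_iff 𝒜 ha).1 haP))
    (le_of_isHomogeneous 𝒜 hp.homogeneous fun _ ha hap => (mem_core_iff 𝒜 ha).2 (hpP hap))

/-- A form of going down: p misses every product of a homogeneous element outside p with an element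
outside Q, so some prime containing p misses all of these too. -/
lemma IsDPrime.exists_isPrime_le {p Q : Ideal S} (hp : IsDPrime 𝒜 p) [hQ : Q.IsPrime]
    (hpQ : p ≤ Q) : ∃ P : Ideal S, P.IsPrime ∧ P ≤ Q ∧ (P.homogeneousCore 𝒜).toIdeal = p := by
  have hdisj : Disjoint (p : Set S) (hp.homogeneousCompl ⊔ Q.primeCompl : Submonoid S) := by
    rw [Set.disjoint_left]
    intro x hx hx'
    obtain ⟨a, ha, b, hb, rfl⟩ := Submonoid.mem_sup.1 hx'
    exact (hp.mem_or_mem_of_mul ha.1 hx).elim ha.2 fun h => hb (hpQ h)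
  obtain ⟨P, hP, hpP, hPM⟩ := Ideal.exists_le_prime_disjoint p _ hdisj
  rw [Set.disjoint_left] at hPM
  refine ⟨P, hP, fun x hx => ?_, hp.core_eq hpP fun a ha haP => ?_⟩
  · by_contra hxQ
    exact hPM hx (Submonoid.mem_sup_right hxQ)
  · by_contra hap
    exact hPM haP (Submonoid.mem_sup_left ⟨ha, hap⟩)

lemma IsDPrime.exists_isPrime {p : Ideal S} (hp : IsDPrime 𝒜 p) :
    ∃ P : Ideal S, P.IsPrime ∧ p ≤ P ∧ (P.homogeneousCore 𝒜).toIdeal = p := by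
  obtain ⟨M, hM, hpM⟩ := Ideal.exists_le_maximal p hp.ne_top
  have := hM.isPrime
  obtain ⟨P, hP, -, h⟩ := hp.exists_isPrime_le hpM
  exact ⟨P, hP, h ▸ Ideal.toIdeal_homogeneousCore_le 𝒜 P, h⟩

/-- Here I need not be graded; only its homogeneous elements must lie in q for I to miss the
multiplicative set of homogeneous elements outside q. -/
lemma IsDPrime.exists_isPrime_core_le {q I : Ideal S} (hq : IsDPrime 𝒜 q)
    (h : ∀ a, SetLike.IsHomogeneousElem 𝒜 a → a ∈ I → a ∈ q) :
    ∃ P : Ideal S, P.IsPrime ∧ I ≤ P ∧ (P.homogeneousCore 𝒜).toIdeal ≤ q := by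
  have hdisj : Disjoint (I : Set S) hq.homogeneousCompl :=
    Set.disjoint_left.2 fun x hx hx' => hx'.2 (h x hx'.1 hx)
  obtain ⟨P, hP, hIP, hPM⟩ := Ideal.exists_le_prime_disjoint I _ hdisj
  refine ⟨P, hP, hIP, le_of_isHomogeneous 𝒜 (HomogeneousIdeal.isHomogeneous _)
    fun a ha haP => ?_⟩
  by_contra haq
  exact Set.disjoint_left.1 hPM ((mem_core_iff 𝒜 ha).1 haP) ⟨ha, haq⟩

end Algebra

/-! ### Relevant elements and homogeneous units of S_f -/

section Relevant

/-- The power `f ^ n` as an element of the submonoid of powers of `f`. -/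
abbrev powersMk {S : Type u} [CommRing S] (f : S) (n : ℕ) : Submonoid.powers f := ⟨f ^ n, n, rfl⟩

variable {D : Type u} [AddCommGroup D] [DecidableEq D] {S : Type u} [CommRing S]
  {𝒜 : D → AddSubgroup S} [GradedRing 𝒜]

/-- A unit of `S_f` of degree `d` is `c / f ^ n` with `c` homogeneous and dividing a power
of `f`. -/
lemma exists_dvd_pow_of_unit {f : S} {m : D} (hf : f ∈ 𝒜 m) {d : D}
    (u : (Localization (Submonoid.powers f))ˣ)
    (hu : (u : Localization (Submonoid.powers f)) ∈ locGrading 𝒜 (Submonoid.powers f) d) :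
    ∃ (i j : D) (n N : ℕ) (a c : S), a ∈ 𝒜 i ∧ f ^ n ∈ 𝒜 j ∧ i - j = d ∧ c ∈ 𝒜 (N • m - i) ∧
      a * c = f ^ N ∧ (u : Localization (Submonoid.powers f)) = Localization.mk a (powersMk f n) := by
  obtain ⟨i, j, a, ⟨_, n, rfl⟩, ha, hs, hd, hx⟩ := hu
  obtain ⟨⟨c, ⟨_, k, rfl⟩⟩, hc⟩ := Localization.mkHom_surjective (u⁻¹ : (Localization (Submonoid.powers f))ˣ).1
  have h : Localization.mk a (powersMk f n) * Localization.mk c (powersMk f k) =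
      (1 : Localization (Submonoid.powers f)) := by
    have := u.mul_inv
    rw [hx, ← hc] at this
    exact this
  rw [Localization.mk_mul, ← Localization.mk_one, Localization.mk_eq_mk_iff,
    Localization.r_iff_exists] at h
  obtain ⟨⟨_, l, rfl⟩, h⟩ := h
  simp only [Submonoid.coe_mul, OneMemClass.coe_one, one_mul, mul_one] at h
  have hN : f ^ (l + (n + k)) ∈ 𝒜 ((l + (n + k)) • m) := SetLike.pow_mem_graded _ hf
  have h1 : a * (f ^ l * c) = f ^ (l + (n + k)) := by rw [pow_add, pow_add, ← h]; ring
  -- Since a and the power of f are homogeneous, the cofactor can be replaced by its component in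
  -- the complementary degree.
  refine ⟨i, j, n, l + (n + k), a, (DirectSum.decompose 𝒜 (f ^ l * c)
    ((l + (n + k)) • m - i) : S), ha, hs, hd, SetLike.coe_mem _, ?_, hx⟩
  rw [← DirectSum.coe_decompose_mul_add_of_left_mem 𝒜 ha, h1, add_sub_cancel,
    DirectSum.decompose_of_mem_same 𝒜 hN]

lemma unit_mem_locGrading_neg {f : S} {m : D} (hf : f ∈ 𝒜 m) {d : D}
    (u : (Localization (Submonoid.powers f))ˣ)
    (hu : (u : Localization (Submonoid.powers f)) ∈ locGrading 𝒜 (Submonoid.powers f) d) :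
    ((u⁻¹ : (Localization (Submonoid.powers f))ˣ) : Localization (Submonoid.powers f)) ∈
      locGrading 𝒜 (Submonoid.powers f) (-d) := by
  obtain ⟨i, j, n, N, a, c, ha, hs, hd, hc, hac, hx⟩ := exists_dvd_pow_of_unit hf u hu
  refine ⟨j + (N • m - i), N • m, f ^ n * c, powersMk f N, SetLike.mul_mem_graded hs hc,
    SetLike.pow_mem_graded _ hf, by rw [← hd]; abel, ?_⟩
  refine Units.inv_eq_of_mul_eq_one_right ?_
  rw [hx, Localization.mk_mul, ← Localization.mk_one, Localization.mk_eq_mk_iff,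
    Localization.r_iff_exists]
  refine ⟨1, ?_⟩
  simp only [Submonoid.coe_mul, OneMemClass.coe_one, one_mul, mul_one]
  rw [← hac]; ring

/-- With e the index of the subgroup of unit degrees, e d is the degree of a unit a / f^n with a c =
f^N. The numerator f^n c of its inverse is the required element. It is used to move a power of a
degree-d element into a multiple of the degree of f. -/
lemma IsRelevant.exists_dvd_pow {f : S} (hf : IsRelevant 𝒜 f) {m : D} (hm : f ∈ 𝒜 m) (d : D) :
    ∃ (e n N : ℕ) (c : S), 0 < e ∧ c ∈ 𝒜 (n • m - e • d) ∧ c ∣ f ^ N := by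
  obtain ⟨H, hH, hHd⟩ := hf.2
  obtain ⟨u, hu⟩ := (hHd (H.index • d)).1 (H.nsmul_index_mem d)
  obtain ⟨i, j, n, N, a, c, ha, hs, hd, hc, hac, hx⟩ := exists_dvd_pow_of_unit hm u hu
  by_cases h0 : f ^ n = 0
  · exact ⟨H.index, 0, n, 0, Nat.pos_of_ne_zero hH.index_ne_zero, zero_mem _, h0 ▸ dvd_rfl⟩
  · have hj : j = n • m := DirectSum.degree_eq_of_mem_mem 𝒜 hs (SetLike.pow_mem_graded n hm) h0
    refine ⟨H.index, N, N + n, f ^ n * c, Nat.pos_of_ne_zero hH.index_ne_zero, ?_, a, ?_⟩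
    · have := SetLike.mul_mem_graded hs hc
      rwa [show j + (N • m - i) = N • m - H.index • d by rw [← hd]; abel] at this
    · rw [pow_add, ← hac]; ring

/-- Homogeneous units of S_f remain units of the same degree in S_(bf) localized at all powers of
bf, so the group of unit degrees can only grow. -/
lemma IsRelevant.mul {f b : S} (hf : IsRelevant 𝒜 f) (hb : SetLike.IsHomogeneousElem 𝒜 b) :
    IsRelevant 𝒜 (b * f) := by
  obtain ⟨⟨m, hm⟩, H, hH, hHd⟩ := hf
  obtain ⟨i, hi⟩ := hb
  have hbf : b * f ∈ 𝒜 (i + m) := SetLike.mul_mem_graded hi hm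
  refine ⟨⟨_, hbf⟩, ?_⟩
  let H' : AddSubgroup D :=
    { carrier := {d | ∃ u : (Localization (Submonoid.powers (b * f)))ˣ,
        (u : Localization (Submonoid.powers (b * f))) ∈
          locGrading 𝒜 (Submonoid.powers (b * f)) d}
      zero_mem' := ⟨1, 0, 0, 1, 1, SetLike.GradedOne.one_mem, SetLike.GradedOne.one_mem,
        sub_zero 0, Localization.mk_one.symm⟩
      add_mem' := by
        rintro _ _ ⟨u, i, j, a, s, ha, hs, rfl, hu⟩ ⟨v, i', j', a', s', ha', hs', rfl, hv⟩
        exact ⟨u * v, i + i', j + j', a * a', s * s', SetLike.mul_mem_graded ha ha',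
          SetLike.mul_mem_graded hs hs', by abel,
          by rw [Units.val_mul, hu, hv, Localization.mk_mul]⟩
      neg_mem' := by
        rintro d ⟨u, hu⟩
        exact ⟨u⁻¹, unit_mem_locGrading_neg hbf u hu⟩ }
  have hle : H ≤ H' := by
    intro d hd
    obtain ⟨u, hu⟩ := (hHd d).1 hd
    obtain ⟨i', j, n, N, a, c, ha, hs, hd, hc, hac, -⟩ := exists_dvd_pow_of_unit hm u hu
    -- These are a / f^n and its inverse f^n c / f^N, rewritten with powers of bf as denominators.
    have hmul : Localization.mk (a * b ^ n) (powersMk (b * f) n) *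
        Localization.mk ((b * f) ^ n * (c * b ^ N * f ^ n)) (powersMk (b * f) (n + N)) =
        (1 : Localization (Submonoid.powers (b * f))) := by
      rw [Localization.mk_mul, ← Localization.mk_one, Localization.mk_eq_mk_iff,
        Localization.r_iff_exists]
      refine ⟨1, ?_⟩
      simp only [Submonoid.coe_mul, OneMemClass.coe_one, one_mul, mul_one]
      have : (b * f) ^ (n + N) = b ^ n * b ^ N * f ^ n * (a * c) := by
        rw [hac, mul_pow, pow_add, pow_add]; ring
      rw [this, mul_pow]; ring
    refine ⟨Units.mkOfMulEqOne _ _ hmul, i' + n • i, j + n • i, a * b ^ n, (powersMk (b * f) n),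
      SetLike.mul_mem_graded ha (SetLike.pow_mem_graded _ hi), ?_, by rw [← hd]; abel, rfl⟩
    change (b * f) ^ n ∈ _
    rw [mul_pow, mul_comm]
    exact SetLike.mul_mem_graded hs (SetLike.pow_mem_graded _ hi)
  exact ⟨H', AddSubgroup.finiteIndex_of_le hle, fun d => Iff.rfl⟩

/-- A `D`-prime ideal not containing `B` avoids a relevant element of `B`. -/
lemma exists_relevant_notMem {B : Ideal S} (hB : IsConical 𝒜 B) {p : Ideal S}
    (hp : IsDPrime 𝒜 p) (hBp : ¬ B ≤ p) : ∃ f : Rel 𝒜 B, f.1 ∉ p := by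
  obtain ⟨b, hb, hbB, hbp⟩ : ∃ b, SetLike.IsHomogeneousElem 𝒜 b ∧ b ∈ B ∧ b ∉ p := by
    by_contra! h
    exact hBp (le_of_isHomogeneous 𝒜 hB.homogeneous h)
  obtain ⟨g, hg, hgp⟩ : ∃ g, IsRelevant 𝒜 g ∧ g ∉ p := by
    by_contra! h
    exact hBp (hB.le_irrelevant.trans (Ideal.span_le.2 h))
  -- The relevant g need not lie in B; multiplying by b puts it there and keeps it relevant.
  exact ⟨⟨b * g, B.mul_mem_right _ hbB, hg.mul hb⟩, fun h =>
    (hp.mem_or_mem _ _ hb hg.1 h).elim hbp hgp⟩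

lemma iUnion_basicOpen {B : Ideal S} (hB : IsConical 𝒜 B) :
    (⋃ f : Rel 𝒜 B, basicOpen 𝒜 B f.1) = Set.univ :=
  Set.eq_univ_of_forall fun p =>
    Set.mem_iUnion.2 (exists_relevant_notMem hB p.2.1 p.2.2)

end Relevant

/-! ### Passing between S, S_f and the degree-zero part S_(f) -/

section Contraction

variable {D : Type u} [AddCommGroup D] [DecidableEq D] {S : Type u} [CommRing S]
  {𝒜 : D → AddSubgroup S} [GradedRing 𝒜]

lemma mk_mem_contraction_iff {f : S} (hf : SetLike.IsHomogeneousElem 𝒜 f) {p : Ideal S}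
    (hp : IsDPrime 𝒜 p) (hfp : f ∉ p)
    (x : HomogeneousLocalization.NumDenSameDeg 𝒜 (Submonoid.powers f)) :
    HomogeneousLocalization.mk x ∈ contraction 𝒜 f p ↔ (x.num : S) ∈ p := by
  rw [contraction, Ideal.mem_comap, HomogeneousLocalization.algebraMap_apply,
    HomogeneousLocalization.val_mk, Localization.mk_eq_mk',
    IsLocalization.mk'_mem_map_algebraMap_iff]
  constructor
  · rintro ⟨_, ⟨n, rfl⟩, h⟩
    obtain ⟨d, hd⟩ := hf
    exact (hp.mem_or_mem_of_mul ⟨_, SetLike.pow_mem_graded n hd⟩ h).resolve_left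
      (hp.pow_notMem ⟨d, hd⟩ hfp n)
  · intro h
    exact ⟨1, one_mem _, by simpa using h⟩

/-- Membership of a homogeneous `a` in a `D`-prime ideal `p` not containing `f` can be tested in
`S_(f)`. -/
lemma IsRelevant.exists_mem_contraction_iff {f : S} (hf : IsRelevant 𝒜 f) {a : S}
    (ha : SetLike.IsHomogeneousElem 𝒜 a) :
    ∃ x : HomogeneousLocalization.Away 𝒜 f, ∀ p : Ideal S, IsDPrime 𝒜 p → f ∉ p →
      (x ∈ contraction 𝒜 f p ↔ a ∈ p) := by
  obtain ⟨m, hm⟩ := hf.1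
  obtain ⟨d, hd⟩ := ha
  obtain ⟨e, n, N, c, he, hc, hcN⟩ := hf.exists_dvd_pow hm d
  have hac : a ^ e * c ∈ 𝒜 (n • m) := by
    have := SetLike.mul_mem_graded (SetLike.pow_mem_graded e hd) hc
    rwa [add_sub_cancel] at this
  -- The test element is a^e c / f^n; c is invisible to p because it divides a power of f.
  refine ⟨HomogeneousLocalization.mk ⟨n • m, ⟨_, hac⟩, ⟨f ^ n, SetLike.pow_mem_graded n hm⟩,
    ⟨n, rfl⟩⟩, fun p hp hfp => ?_⟩
  rw [mk_mem_contraction_iff hf.1 hp hfp]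
  change a ^ e * c ∈ p ↔ a ∈ p
  refine ⟨fun h => ?_, fun h => p.mul_mem_right _ (p.pow_mem_of_mem h e he)⟩
  by_contra hap
  have hcp := (hp.mem_or_mem_of_mul ⟨_, SetLike.pow_mem_graded e hd⟩ h).resolve_left
    (hp.pow_notMem ⟨d, hd⟩ hap e)
  exact hp.pow_notMem hf.1 hfp N (p.mem_of_dvd hcN hcp)

/-- `D_+(f) → Spec S_(f)` sends the homogeneous core of a prime of `S_f` to its contraction. -/
lemma contraction_core {f : S} (hf : SetLike.IsHomogeneousElem 𝒜 f)
    (q : Ideal (Localization.Away f)) [hq : q.IsPrime] :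
    contraction 𝒜 f ((q.comap (algebraMap S (Localization.Away f))).homogeneousCore 𝒜).toIdeal =
      q.comap (algebraMap (HomogeneousLocalization.Away 𝒜 f) (Localization.Away f)) := by
  have hfq : f ∉ q.comap (algebraMap S (Localization.Away f)) := fun h =>
    hq.ne_top (Ideal.eq_top_of_isUnit_mem _ h (IsLocalization.Away.algebraMap_isUnit f))
  ext y
  obtain ⟨x, rfl⟩ := HomogeneousLocalization.mk_surjective y
  rw [mk_mem_contraction_iff hf (isDPrime_core 𝒜 _) (fun h => hfq ((mem_core_iff 𝒜 hf).1 h)),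
    mem_core_iff 𝒜 ⟨_, x.num.2⟩, Ideal.mem_comap, Ideal.mem_comap,
    HomogeneousLocalization.algebraMap_apply, HomogeneousLocalization.val_mk,
    Localization.mk_eq_mk', ← IsLocalization.mk'_spec (Localization.Away f) (x.num : S)
      ⟨(x.den : S), x.den_mem⟩]
  exact Ideal.mul_unit_mem_iff_mem _ (IsLocalization.map_units (Localization.Away f)
    (⟨(x.den : S), x.den_mem⟩ : Submonoid.powers f))

/-- Taking the degree-zero part is an S_(f)-linear retraction of S_f onto S_(f), and it carries the
extension of q back into q. -/
lemma comap_map_away {f : S} (hf : SetLike.IsHomogeneousElem 𝒜 f)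
    (q : Ideal (HomogeneousLocalization.Away 𝒜 f)) :
    (q.map (algebraMap (HomogeneousLocalization.Away 𝒜 f) (Localization.Away f))).comap
      (algebraMap (HomogeneousLocalization.Away 𝒜 f) (Localization.Away f)) = q := by
  obtain ⟨m, hm⟩ := hf
  refine le_antisymm (fun r hr => ?_) Ideal.le_comap_map
  -- The degree-zero part of b / f^n is written as the component of b in degree n m, over f^n.
  -- Asking only for some representative avoids showing that this is independent of the fraction.
  have key : ∀ y ∈ q.map (algebraMap (HomogeneousLocalization.Away 𝒜 f) (Localization.Away f)),
      ∃ (b : S) (n : ℕ), y = Localization.mk b (powersMk f n) ∧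
        HomogeneousLocalization.Away.mk 𝒜 hm n (DirectSum.decompose 𝒜 b (n • m))
          (SetLike.coe_mem _) ∈ q := by
    intro y hy
    induction hy using Submodule.closure_induction with
    | zero =>
      refine ⟨0, 0, (Localization.mk_zero _).symm, ?_⟩
      convert q.zero_mem
      apply HomogeneousLocalization.val_injective
      rw [HomogeneousLocalization.Away.val_mk, DirectSum.decompose_zero,
        HomogeneousLocalization.val_zero]
      exact Localization.mk_zero (powersMk f 0)
    | add y z _ _ hy hz =>
      obtain ⟨b, n, rfl, hb⟩ := hy
      obtain ⟨b', n', rfl, hb'⟩ := hz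
      have hn := SetLike.pow_mem_graded n hm
      have hn' := SetLike.pow_mem_graded n' hm
      refine ⟨f ^ n * b' + f ^ n' * b, n + n', ?_, ?_⟩
      · rw [Localization.add_mk]
        congr 1
        exact Subtype.ext (pow_add f n n').symm
      · convert q.add_mem hb hb'
        apply HomogeneousLocalization.val_injective
        rw [HomogeneousLocalization.val_add, HomogeneousLocalization.Away.val_mk,
          HomogeneousLocalization.Away.val_mk, HomogeneousLocalization.Away.val_mk,
          Localization.add_mk]
        congr 1
        · rw [DirectSum.decompose_add, DirectSum.add_apply, AddMemClass.coe_add, add_smul,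
            DirectSum.coe_decompose_mul_add_of_left_mem 𝒜 hn, add_comm (n • m),
            DirectSum.coe_decompose_mul_add_of_left_mem 𝒜 hn']
        · exact Subtype.ext (pow_add f n n')
    | smul_mem s y hy =>
      obtain ⟨y, hy, rfl⟩ := hy
      obtain ⟨k, a, ha, rfl⟩ := HomogeneousLocalization.Away.mk_surjective 𝒜 hm y
      obtain ⟨⟨b, ⟨_, n, rfl⟩⟩, rfl⟩ := Localization.mkHom_surjective s
      refine ⟨b * a, n + k, ?_, ?_⟩
      · rw [HomogeneousLocalization.algebraMap_apply, HomogeneousLocalization.Away.val_mk]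
        change Localization.mk _ _ * _ = _
        rw [Localization.mk_mul]
        congr 1
        exact Subtype.ext (pow_add f n k).symm
      · convert q.mul_mem_left (HomogeneousLocalization.Away.mk 𝒜 hm n
          (DirectSum.decompose 𝒜 b (n • m)) (SetLike.coe_mem _)) hy
        apply HomogeneousLocalization.val_injective
        rw [HomogeneousLocalization.val_mul, HomogeneousLocalization.Away.val_mk,
          HomogeneousLocalization.Away.val_mk, HomogeneousLocalization.Away.val_mk,
          Localization.mk_mul]
        congr 1
        · rw [add_smul, DirectSum.coe_decompose_mul_add_of_right_mem 𝒜 ha]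
        · exact Subtype.ext (pow_add f n k)
  obtain ⟨b, n, hb, hq⟩ := key _ hr
  obtain ⟨k, a, ha, rfl⟩ := HomogeneousLocalization.Away.mk_surjective 𝒜 hm r
  convert hq using 1
  apply HomogeneousLocalization.val_injective
  rw [HomogeneousLocalization.algebraMap_apply, HomogeneousLocalization.Away.val_mk,
    Localization.mk_eq_mk_iff, Localization.r_iff_exists] at hb
  rw [HomogeneousLocalization.Away.val_mk, HomogeneousLocalization.Away.val_mk,
    Localization.mk_eq_mk_iff, Localization.r_iff_exists]
  obtain ⟨⟨_, l, rfl⟩, hb⟩ := hb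
  refine ⟨⟨_, l, rfl⟩, ?_⟩
  have hl := SetLike.pow_mem_graded l hm
  have hn := SetLike.pow_mem_graded n hm
  have hk := SetLike.pow_mem_graded k hm
  -- Both sides are compared in the degree where the numerator a, of degree k m, contributes in
  -- full.
  have := congrArg (fun t => (DirectSum.decompose 𝒜 t (l • m + (k • m + n • m)) : S)) hb
  simp only [] at this
  rw [DirectSum.coe_decompose_mul_add_of_left_mem 𝒜 hl,
    DirectSum.coe_decompose_mul_add_of_left_mem 𝒜 hl,
    DirectSum.coe_decompose_mul_add_of_left_mem 𝒜 hk, add_comm (k • m),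
    DirectSum.coe_decompose_mul_add_of_left_mem 𝒜 hn,
    DirectSum.decompose_of_mem_same 𝒜 ha] at this
  exact this

lemma exists_isPrime_comap_away {f : S} (hf : SetLike.IsHomogeneousElem 𝒜 f)
    (q : Ideal (HomogeneousLocalization.Away 𝒜 f)) [q.IsPrime] :
    ∃ Q : Ideal (Localization.Away f), Q.IsPrime ∧
      Q.comap (algebraMap (HomogeneousLocalization.Away 𝒜 f) (Localization.Away f)) = q :=
  (Ideal.comap_map_eq_self_iff_of_isPrime q).1 (comap_map_away hf q)

end Contraction

/-! ### The maps ψ_f are homeomorphisms -/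

section Psi

variable {D : Type u} [AddCommGroup D] [DecidableEq D] {S : Type u} [CommRing S]
  {𝒜 : D → AddSubgroup S} [GradedRing 𝒜] {B : Ideal S}

/-- The homogeneous core of a prime ideal not containing `B`, as a point of `Proj`. -/
def corePoint (𝒜 : D → AddSubgroup S) [GradedRing 𝒜] (B : Ideal S) (P : Ideal S) [P.IsPrime]
    (h : ¬ B ≤ P) : ProjD 𝒜 B :=
  ⟨(P.homogeneousCore 𝒜).toIdeal, isDPrime_core 𝒜 P,
    fun h' => h (h'.trans (Ideal.toIdeal_homogeneousCore_le 𝒜 P))⟩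

lemma psi_injective (f : Rel 𝒜 B) : Function.Injective (psi 𝒜 f) := by
  intro p p' h
  have h' : contraction 𝒜 f.1 p.1.1 = contraction 𝒜 f.1 p'.1.1 :=
    congrArg PrimeSpectrum.asIdeal h
  refine Subtype.ext (Subtype.ext (le_antisymm ?_ ?_))
  · refine le_of_isHomogeneous 𝒜 p.1.2.1.homogeneous fun a ha hap => ?_
    obtain ⟨x, hx⟩ := f.2.2.exists_mem_contraction_iff ha
    exact (hx _ p'.1.2.1 p'.2).1 (h' ▸ (hx _ p.1.2.1 p.2).2 hap)
  · refine le_of_isHomogeneous 𝒜 p'.1.2.1.homogeneous fun a ha hap => ?_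
    obtain ⟨x, hx⟩ := f.2.2.exists_mem_contraction_iff ha
    exact (hx _ p.1.2.1 p.2).1 (h'.symm ▸ (hx _ p'.1.2.1 p'.2).2 hap)

lemma psi_surjective (f : Rel 𝒜 B) : Function.Surjective (psi 𝒜 f) := by
  intro q
  have hqp : Ideal.IsPrime (PrimeSpectrum.asIdeal q) := q.2
  obtain ⟨Q, hQ, hQq⟩ := exists_isPrime_comap_away f.2.2.1 (PrimeSpectrum.asIdeal q)
  have hfQ : f.1 ∉ ((Q.comap (algebraMap S (Localization.Away f.1))).homogeneousCore 𝒜).toIdeal :=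
    fun h => hQ.ne_top (Ideal.eq_top_of_isUnit_mem _ ((mem_core_iff 𝒜 f.2.2.1).1 h)
      (IsLocalization.Away.algebraMap_isUnit f.1))
  refine ⟨⟨⟨_, isDPrime_core 𝒜 (Q.comap (algebraMap S (Localization.Away f.1))),
    fun h => hfQ (h f.2.1)⟩, hfQ⟩, ?_⟩
  apply PrimeSpectrum.ext
  exact (contraction_core f.2.2.1 Q).trans hQq

lemma psi_continuous (f : Rel 𝒜 B) : Continuous (psi 𝒜 f) := by
  refine PrimeSpectrum.isTopologicalBasis_basic_opens.continuous_iff.2 ?_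
  rintro _ ⟨y, rfl⟩
  obtain ⟨x, rfl⟩ := HomogeneousLocalization.mk_surjective y
  have : psi 𝒜 f ⁻¹' (PrimeSpectrum.basicOpen (HomogeneousLocalization.mk x)).1 =
      Subtype.val ⁻¹' basicOpen 𝒜 B (x.num : S) := by
    ext p
    exact not_congr (mk_mem_contraction_iff f.2.2.1 p.1.2.1 p.2 x)
  exact this ▸ (isOpen_basicOpen 𝒜 B ⟨_, x.num.2⟩).preimage continuous_subtype_val

lemma isClosed_iff_zeroLocus {Z : Set (ProjD 𝒜 B)} :
    IsClosed Z ↔ ∃ E : Set S, (∀ f ∈ E, SetLike.IsHomogeneousElem 𝒜 f) ∧ Z = zeroLocus 𝒜 B E := by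
  rw [← isOpen_compl_iff]
  exact ⟨fun ⟨E, hE, h⟩ => ⟨E, hE, by rw [← h, compl_compl]⟩,
    fun ⟨E, hE, h⟩ => ⟨E, hE, by rw [h, compl_compl]⟩⟩

/-- Each homogeneous equation has a test element in S_(f) with the same zeros on D_+(f), so a closed
set goes to the zero locus of the test elements. -/
lemma psi_isClosedMap (f : Rel 𝒜 B) : IsClosedMap (psi 𝒜 f) := by
  intro Z hZ
  obtain ⟨Z, hZ', rfl⟩ := isClosed_induced_iff.1 hZ
  obtain ⟨E, hE, rfl⟩ := isClosed_iff_zeroLocus.1 hZ'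
  choose! x hx using fun a (ha : a ∈ E) => f.2.2.exists_mem_contraction_iff (hE a ha)
  have : psi 𝒜 f '' (Subtype.val ⁻¹' zeroLocus 𝒜 B E) = PrimeSpectrum.zeroLocus (x '' E) := by
    ext q
    obtain ⟨p, rfl⟩ := psi_surjective f q
    rw [(psi_injective f).mem_set_image]
    change E ⊆ p.1.1 ↔ x '' E ⊆ contraction 𝒜 f.1 p.1.1
    rw [Set.image_subset_iff]
    exact forall₂_congr fun a ha => (hx a ha _ p.1.2.1 p.2).symm
  rw [this]
  exact PrimeSpectrum.isClosed_zeroLocus _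

lemma psi_isHomeomorph (f : Rel 𝒜 B) : IsHomeomorph (psi 𝒜 f) :=
  isHomeomorph_iff_continuous_isClosedMap_bijective.2
    ⟨psi_continuous f, psi_isClosedMap f, psi_injective f, psi_surjective f⟩

end Psi

/-! ### Primes with the same core lie in one orbit -/

section Orbit

open scoped TensorProduct in
/-- Two extensions of a field embed into a common algebraically closed field. -/
lemma exists_common_extension (F K L : Type u) [Field F] [Field K] [Field L] [Algebra F K]
    [Algebra F L] : ∃ (k : Type u) (_ : Field k) (_ : IsAlgClosed k) (i : K →+* k) (j : L →+* k),
      i.comp (algebraMap F K) = j.comp (algebraMap F L) := by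
  -- The tensor product of two field extensions is nonzero, so it has a residue field, which
  -- receives both.
  obtain ⟨M, hM⟩ := Ideal.exists_maximal (K ⊗[F] L)
  let _ := Ideal.Quotient.field M
  let κ : K ⊗[F] L →+* AlgebraicClosure ((K ⊗[F] L) ⧸ M) :=
    (algebraMap ((K ⊗[F] L) ⧸ M) _).comp (Ideal.Quotient.mk M)
  refine ⟨AlgebraicClosure ((K ⊗[F] L) ⧸ M), inferInstance, inferInstance,
    κ.comp (algebraMap K (K ⊗[F] L)),
    κ.comp (Algebra.TensorProduct.includeRight : L →ₐ[F] K ⊗[F] L).toRingHom, ?_⟩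
  ext r
  exact congrArg κ ((IsScalarTower.algebraMap_apply F K (K ⊗[F] L) _).symm.trans
    ((Algebra.TensorProduct.includeRight : L →ₐ[F] K ⊗[F] L).commutes _).symm)

/-- Two field-valued points of a ring with the same kernel become equal in an algebraically closed
field. -/
lemma exists_common_field {R K L : Type u} [CommRing R] [Field K] [Field L] (a : R →+* K)
    (b : R →+* L) (h : ∀ r, a r = 0 ↔ b r = 0) :
    ∃ (k : Type u) (_ : Field k) (_ : IsAlgClosed k) (i : K →+* k) (j : L →+* k),
      i.comp a = j.comp b := by
  let a' : R ⧸ RingHom.ker a →+* K := RingHom.kerLift a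
  have ha' : Function.Injective a' := RingHom.kerLift_injective a
  let b' : R ⧸ RingHom.ker a →+* L := Ideal.Quotient.lift _ b fun r hr => (h r).1 hr
  have hb' : Function.Injective b' := by
    rw [injective_iff_map_eq_zero]
    intro r hr
    obtain ⟨r, rfl⟩ := Ideal.Quotient.mk_surjective r
    exact Ideal.Quotient.eq_zero_iff_mem.2 ((h r).2 hr)
  have : (RingHom.ker a).IsPrime := RingHom.ker_isPrime a
  let F := FractionRing (R ⧸ RingHom.ker a)
  let _ : Algebra F K := (IsFractionRing.lift (K := F) ha').toAlgebra
  let _ : Algebra F L := (IsFractionRing.lift (K := F) hb').toAlgebra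
  obtain ⟨k, hk, hk', i, j, hij⟩ := exists_common_extension F K L
  refine ⟨k, hk, hk', i, j, ?_⟩
  ext r
  have h1 : a r = algebraMap F K (algebraMap _ F (Ideal.Quotient.mk (RingHom.ker a) r)) :=
    (IsFractionRing.lift_algebraMap (K := F) ha'
      (Ideal.Quotient.mk (RingHom.ker a) r)).symm
  have h2 : b r = algebraMap F L (algebraMap _ F (Ideal.Quotient.mk (RingHom.ker a) r)) :=
    (IsFractionRing.lift_algebraMap (K := F) hb'
      (Ideal.Quotient.mk (RingHom.ker a) r)).symm
  rw [RingHom.comp_apply, RingHom.comp_apply, h1, h2]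
  exact DFunLike.congr_fun hij _

/-- Characters of a subgroup with values in an algebraically closed field extend. -/
lemma exists_character_extension {D : Type u} [AddCommGroup D] {k : Type u} [Field k]
    [IsAlgClosed k] (G : AddSubgroup (D × Additive kˣ)) (hG : ∀ t, ((0 : D), t) ∈ G → t = 0) :
    ∃ χ : D →+ Additive kˣ, ∀ d t, (d, t) ∈ G → χ d = t := by
  -- Roots exist in k, so kˣ is divisible, hence an injective abelian group. The subgroup G is the
  -- graph of a partial homomorphism, which therefore extends.
  let _ : RootableBy kˣ ℕ := rootableByOfPowLeftSurj _ _ fun {n} hn u => by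
    obtain ⟨z, hz⟩ := IsAlgClosed.exists_pow_nat_eq (u : k) (Nat.pos_of_ne_zero hn)
    refine ⟨Units.mk0 z ?_, Units.ext hz⟩
    rintro rfl
    rw [zero_pow hn] at hz
    exact u.ne_zero hz.symm
  let _ : DivisibleBy (Additive kˣ) ℕ :=
    { div := fun a n => Additive.ofMul (RootableBy.root a.toMul n)
      div_zero := fun a => congrArg Additive.ofMul (RootableBy.root_zero a.toMul)
      div_cancel := fun a h => congrArg Additive.ofMul (RootableBy.root_cancel a.toMul h) }
  let _ : DivisibleBy (Additive kˣ) ℤ := AddGroup.divisibleByIntOfDivisibleByNat _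
  have hinj : Function.Injective ((AddMonoidHom.fst D (Additive kˣ)).comp G.subtype) := by
    rw [injective_iff_map_eq_zero]
    rintro ⟨⟨d, t⟩, h⟩ (rfl : d = 0)
    exact Subtype.ext (Prod.ext rfl (hG t h))
  obtain ⟨χ, hχ⟩ := (Module.Baer.of_divisible (Additive kˣ)).extension_property_addMonoidHom _ hinj
    ((AddMonoidHom.snd D (Additive kˣ)).comp G.subtype)
  exact ⟨χ, fun d t h => DFunLike.congr_fun hχ (⟨(d, t), h⟩ : G)⟩

variable {D : Type u} [AddCommGroup D] [DecidableEq D] {S : Type u} [CommRing S]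
  {𝒜 : D → AddSubgroup S} [GradedRing 𝒜]

/-- The last hypothesis says that X and Y agree on S_(f). The character must be Y a / X a on the
degree of any a with X a nonzero; `key` shows that this ratio depends only on the degree. -/
lemma exists_character {f : S} (hf : IsRelevant 𝒜 f) {m : D} (hm : f ∈ 𝒜 m) {k : Type u} [Field k]
    [IsAlgClosed k] (X Y : S →+* k) (hXY : ∀ a, SetLike.IsHomogeneousElem 𝒜 a → (X a = 0 ↔ Y a = 0))
    (hXf : X f ≠ 0) (h : ∀ (n : ℕ) (a : S), a ∈ 𝒜 (n • m) → X a * Y f ^ n = Y a * X f ^ n) :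
    ∃ χ : D →+ Additive kˣ, ∀ d, ∀ a ∈ 𝒜 d, Y a = X a * ((χ d).toMul : kˣ) := by
  have hYf : Y f ≠ 0 := fun h => hXf ((hXY f ⟨m, hm⟩).2 h)
  have key : ∀ (d : D) (a b : S), a ∈ 𝒜 d → b ∈ 𝒜 d → X a ≠ 0 → X b ≠ 0 →
      Y a * X b = Y b * X a := by
    intro d a b ha hb hXa hXb
    have hYa : Y a ≠ 0 := fun h => hXa ((hXY a ⟨d, ha⟩).2 h)
    obtain ⟨e, n, N, c, he, hc, c', hcN⟩ := hf.exists_dvd_pow hm d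
    obtain ⟨e, rfl⟩ := Nat.exists_eq_succ_of_ne_zero he.ne'
    have hXc : X c ≠ 0 := fun h => pow_ne_zero N hXf (by rw [← map_pow, hcN, map_mul, h, zero_mul])
    have hYc : Y c ≠ 0 := fun h => hXc ((hXY c ⟨_, hc⟩).2 h)
    -- After the substitution the exponent is e + 1, so one factor a can be exchanged for b without
    -- leaving degree n m, where X and Y are already comparable.
    have h1 := h n (a ^ e * b * c) (by
      have := SetLike.mul_mem_graded (SetLike.mul_mem_graded (SetLike.pow_mem_graded e ha) hb) hc
      rwa [← succ_nsmul, add_sub_cancel] at this)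
    have h2 := h n (a ^ e * a * c) (by
      have := SetLike.mul_mem_graded (SetLike.mul_mem_graded (SetLike.pow_mem_graded e ha) ha) hc
      rwa [← succ_nsmul, add_sub_cancel] at this)
    simp only [map_mul, map_pow] at h1 h2
    have hne : X a ^ e * X c * (Y a ^ e * Y c) * (X f ^ n * Y f ^ n) ≠ 0 := by
      simp [hXa, hYa, hXc, hYc, hXf, hYf]
    apply mul_left_cancel₀ hne
    linear_combination (Y a ^ e * Y a * Y c * X f ^ n) * h1 - (Y a ^ e * Y b * Y c * X f ^ n) * h2
  -- Differences of degrees paired with quotients of ratios: the partial character forced on the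
  -- subgroup generated by the degrees where X does not vanish.
  let G : AddSubgroup (D × Additive kˣ) :=
    { carrier := {p | ∃ (i j : D) (a b : S), a ∈ 𝒜 i ∧ b ∈ 𝒜 j ∧ X a ≠ 0 ∧ X b ≠ 0 ∧ p.1 = i - j ∧
        (p.2.toMul : kˣ) * (X a * Y b) = Y a * X b}
      zero_mem' := ⟨0, 0, 1, 1, SetLike.GradedOne.one_mem, SetLike.GradedOne.one_mem,
        by simp, by simp, by simp, by simp⟩
      add_mem' := by
        rintro ⟨_, t⟩ ⟨_, t'⟩ ⟨i, j, a, b, ha, hb, hXa, hXb, rfl, h⟩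
          ⟨i', j', a', b', ha', hb', hXa', hXb', rfl, h'⟩
        refine ⟨i + i', j + j', a * a', b * b', SetLike.mul_mem_graded ha ha',
          SetLike.mul_mem_graded hb hb', by simp [hXa, hXa'], by simp [hXb, hXb'], ?_, ?_⟩
        · change i - j + (i' - j') = _
          abel
        · simp only [Prod.mk_add_mk, toMul_add, Units.val_mul, map_mul] at h h' ⊢
          linear_combination (t'.toMul : k) * (X a' * Y b') * h + Y a * X b * h'
      neg_mem' := by
        rintro ⟨_, t⟩ ⟨i, j, a, b, ha, hb, hXa, hXb, rfl, h⟩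
        refine ⟨j, i, b, a, hb, ha, hXb, hXa, (neg_sub i j), ?_⟩
        change ((t.toMul)⁻¹ : kˣ).1 * _ = _
        rw [Units.inv_mul_eq_iff_eq_mul]
        simp only at h
        linear_combination -h }
  obtain ⟨χ, hχ⟩ := exists_character_extension G (by
    rintro t ⟨i, j, a, b, ha, hb, hXa, hXb, hij, h⟩
    obtain rfl : i = j := (sub_eq_zero.1 hij.symm)
    have hYb : Y b ≠ 0 := fun h => hXb ((hXY b ⟨_, hb⟩).2 h)
    have : (t.toMul : kˣ) = 1 := by
      apply Units.ext
      apply mul_right_cancel₀ (mul_ne_zero hXa hYb)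
      simp only [Units.val_one] at h ⊢
      rw [h, key i a b ha hb hXa hXb]
      ring
    exact this)
  refine ⟨χ, fun d a ha => ?_⟩
  by_cases hXa : X a = 0
  · rw [hXa, zero_mul, (hXY a ⟨d, ha⟩).1 hXa]
  · have hYa : Y a ≠ 0 := fun h => hXa ((hXY a ⟨d, ha⟩).2 h)
    have hXu : X a * (Units.mk0 (Y a / X a) (div_ne_zero hYa hXa) : kˣ) = Y a := by
      rw [Units.val_mk0]; field_simp
    rw [hχ d (Additive.ofMul (Units.mk0 (Y a / X a) (div_ne_zero hYa hXa)))]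
    · exact hXu.symm
    · refine ⟨d, 0, a, 1, ha, SetLike.GradedOne.one_mem, hXa, by simp, (sub_zero d).symm, ?_⟩
      rw [map_one, map_one, mul_one, mul_one, mul_comm]
      exact hXu

/-- The two residue points are translates of one another by a k-valued point of the diagonalizable
group. The prime z is the kernel of the k-valued point of Spec S[D] formed by the first residue
point and that character. -/
lemma exists_orbit {f : S} (hf : IsRelevant 𝒜 f) (P P' : Ideal S) [hP : P.IsPrime]
    [hP' : P'.IsPrime] (hcore : ∀ a, SetLike.IsHomogeneousElem 𝒜 a → (a ∈ P ↔ a ∈ P'))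
    (hfP : f ∉ P) :
    ∃ z : Ideal (AddMonoidAlgebra S D), z.IsPrime ∧ z.comap (coaction 𝒜) = P' ∧
      z.comap (AddMonoidAlgebra.singleZeroRingHom : S →+* AddMonoidAlgebra S D) = P := by
  obtain ⟨m, hm⟩ := hf.1
  have hfP' : f ∉ P' := fun h => hfP ((hcore f hf.1).2 h)
  have hker : ∀ (I : Ideal S) [I.IsPrime] (a : S), algebraMap S (FractionRing (S ⧸ I)) a = 0 ↔
      a ∈ I := fun I _ a => by
    rw [IsScalarTower.algebraMap_apply S (S ⧸ I), FaithfulSMul.algebraMap_eq_zero_iff,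
      Ideal.Quotient.algebraMap_eq, Ideal.Quotient.eq_zero_iff_mem]
  have key : ∀ (I : Ideal S) [I.IsPrime], f ∉ I →
      ∃ x : HomogeneousLocalization.Away 𝒜 f →+* FractionRing (S ⧸ I), ∀ (n : ℕ) (a : S)
        (ha : a ∈ 𝒜 (n • m)), x (HomogeneousLocalization.Away.mk 𝒜 hm n a ha) *
          algebraMap S (FractionRing (S ⧸ I)) f ^ n = algebraMap S (FractionRing (S ⧸ I)) a := by
    intro I _ hfI
    have hu : IsUnit (algebraMap S (FractionRing (S ⧸ I)) f) :=
      (isUnit_iff_ne_zero.2 fun h => hfI ((hker I f).1 h))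
    refine ⟨(IsLocalization.Away.lift (S := Localization.Away f) f hu).comp
      (algebraMap (HomogeneousLocalization.Away 𝒜 f) (Localization.Away f)), fun n a ha => ?_⟩
    rw [RingHom.comp_apply, HomogeneousLocalization.algebraMap_apply,
      HomogeneousLocalization.Away.val_mk, ← map_pow,
      ← IsLocalization.Away.lift_eq (S := Localization.Away f) f hu (f ^ n), ← map_mul,
      Localization.mk_eq_mk']
    rw [IsLocalization.mk'_spec (Localization.Away f) a (powersMk f n),
      IsLocalization.Away.lift_eq]
  obtain ⟨x, hx⟩ := key P hfP
  obtain ⟨y, hy⟩ := key P' hfP'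
  have hPf : algebraMap S (FractionRing (S ⧸ P)) f ≠ 0 := fun h => hfP ((hker P f).1 h)
  have hPf' : algebraMap S (FractionRing (S ⧸ P')) f ≠ 0 := fun h => hfP' ((hker P' f).1 h)
  -- The kernels on S_(f) agree because vanishing of a / f^n is decided by its homogeneous
  -- numerator.
  obtain ⟨k, _, _, i, j, hij⟩ := exists_common_field x y (by
    intro r
    obtain ⟨n, a, ha, rfl⟩ := HomogeneousLocalization.Away.mk_surjective 𝒜 hm r
    rw [← mul_left_inj' (pow_ne_zero n hPf), hx, zero_mul, hker,
      ← mul_left_inj' (pow_ne_zero n hPf'), hy, zero_mul, hker]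
    exact hcore a ⟨_, ha⟩)
  let X := i.comp (algebraMap S (FractionRing (S ⧸ P)))
  let Y := j.comp (algebraMap S (FractionRing (S ⧸ P')))
  have hX : ∀ a, X a = 0 ↔ a ∈ P := fun a => (map_eq_zero i).trans (hker P a)
  have hY : ∀ a, Y a = 0 ↔ a ∈ P' := fun a => (map_eq_zero j).trans (hker P' a)
  obtain ⟨χ, hχ⟩ := exists_character hf hm X Y
    (fun a ha => (hX a).trans ((hcore a ha).trans (hY a).symm)) (fun h => hfP ((hX f).1 h)) (by
      intro n a ha
      have h := DFunLike.congr_fun hij (HomogeneousLocalization.Away.mk 𝒜 hm n a ha)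
      simp only [RingHom.comp_apply] at h
      simp only [X, Y, RingHom.comp_apply]
      rw [← hx n a ha, ← hy n a ha, map_mul, map_mul, h, map_pow, map_pow]
      ring)
  -- Composed with the inclusion of S it is X, composed with the coaction it is Y.
  let ζ : AddMonoidAlgebra S D →+* k := AddMonoidAlgebra.liftNCRingHom X
    ((Units.coeHom k).comp (AddMonoidHom.toMultiplicativeLeft χ)) fun _ _ => Commute.all _ _
  have hζ : ∀ d s, ζ (AddMonoidAlgebra.single d s) = X s * ((χ d).toMul : kˣ) := fun d s =>
    AddMonoidAlgebra.liftNC_single _ _ _ _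
  have hζY : ∀ s, ζ (coaction 𝒜 s) = Y s := by
    intro s
    induction s using DirectSum.Decomposition.inductionOn 𝒜 with
    | zero => simp
    | homogeneous a => rw [coaction_of_mem 𝒜 a.2, hζ, hχ _ _ a.2]
    | add a b ha hb => rw [map_add, map_add, ha, hb, map_add]
  have hζX : ∀ s, ζ (AddMonoidAlgebra.singleZeroRingHom s) = X s := by
    intro s
    exact (hζ 0 s).trans (by simp)
  refine ⟨RingHom.ker ζ, RingHom.ker_isPrime ζ, ?_, ?_⟩
  · ext s
    rw [Ideal.mem_comap, RingHom.mem_ker, hζY, hY]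
  · ext s
    rw [Ideal.mem_comap, RingHom.mem_ker, hζX, hX]

end Orbit

/-! ### Sections of a coequalizer of ringed spaces -/

section Sections

open Limits Opposite

/-- Sections of the colimit form a limit over the parallel pair; the component at Y determines the
one at X. -/
lemma coequalizer_π_app_injective {X Y : PresheafedSpace CommRingCat.{u}} (f g : X ⟶ Y)
    (U : Opens (coequalizer f g).carrier) :
    Function.Injective ((coequalizer.π f g).c.app (op U)) := by
  let F := parallelPair f g
  let E := PresheafedSpace.colimitPresheafObjIsoComponentwiseLimit F U
  intro s t hst
  have hE : Function.Injective E.hom := (ConcreteCategory.bijective_of_isIso E.hom).1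
  apply hE
  refine Concrete.limit_ext _ _ _ fun j => ?_
  have h1 : ∀ (j : WalkingParallelPair) r, limit.π (PresheafedSpace.componentwiseDiagram F U) (op j) (E.hom r) =
    (colimit.ι F j).c.app (op U) r := fun j r => by
      rw [← PresheafedSpace.colimitPresheafObjIsoComponentwiseLimit_hom_π]
      rfl
  have h2 : limit.π (PresheafedSpace.componentwiseDiagram F U) (op .one) (E.hom s) =
     limit.π (PresheafedSpace.componentwiseDiagram F U) (op .one) (E.hom t) := by
    rw [h1, h1]; exact hst
  cases j with | op j => ?_
  cases j with
  | one => exact h2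
  | zero =>
    rw [← limit.w (PresheafedSpace.componentwiseDiagram F U) (Quiver.Hom.op WalkingParallelPairHom.left)]
    rw [ConcreteCategory.comp_apply, ConcreteCategory.comp_apply, h2]

/-- The two pullbacks of s live over opens that are equal but not syntactically so. Restricting to
every W below both lets them be compared without a cast. -/
lemma coequalizer_π_app_exists {X Y : PresheafedSpace CommRingCat.{u}} (f g : X ⟶ Y)
    (U : Opens (coequalizer f g).carrier)
    (s : Y.presheaf.obj (op ((Opens.map (coequalizer.π f g).base).obj U)))
    (hs : ∀ (W : Opens X) (h₁ : W ≤ (Opens.map f.base).obj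
      ((Opens.map (coequalizer.π f g).base).obj U)) (h₂ : W ≤ (Opens.map g.base).obj
      ((Opens.map (coequalizer.π f g).base).obj U)),
      X.presheaf.map (homOfLE h₁).op (f.c.app _ s) = X.presheaf.map (homOfLE h₂).op (g.c.app _ s)) :
    ∃ t, (coequalizer.π f g).c.app (op U) t = s := by
  let F := parallelPair f g
  let E := PresheafedSpace.colimitPresheafObjIsoComponentwiseLimit F U
  let G := PresheafedSpace.componentwiseDiagram F U
  have hG : G.map (Quiver.Hom.op WalkingParallelPairHom.left) s =
      G.map (Quiver.Hom.op WalkingParallelPairHom.right) s :=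
    hs ((Opens.map (colimit.ι F .zero).base).obj U)
      (le_of_eq (by rw [← colimit.w F WalkingParallelPairHom.left]; rfl))
      (le_of_eq (by rw [← colimit.w F WalkingParallelPairHom.right]; rfl))
  let e := Types.isLimitEquivSections (isLimitOfPreserves (forget CommRingCat.{u}) (limit.isLimit G))
  let σ : (G ⋙ forget CommRingCat.{u}).sections :=
    ⟨fun j => match j with
      | op .one => s
      | op .zero => G.map (Quiver.Hom.op WalkingParallelPairHom.left) s, by
        rintro ⟨j⟩ ⟨j'⟩ k
        obtain ⟨k, rfl⟩ : ∃ l : WalkingParallelPairHom j' j,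
            k = Quiver.Hom.op (show j' ⟶ j from l) := ⟨k.unop, rfl⟩
        cases k with
        | left => rfl
        | right => exact hG.symm
        | id =>
          exact ConcreteCategory.congr_hom (G.map_id _) _⟩
  have hσ : limit.π G (op .one) (e.symm σ) = s :=
    Types.isLimitEquivSections_symm_apply
      (isLimitOfPreserves (forget CommRingCat.{u}) (limit.isLimit G)) σ (op .one)
  refine ⟨E.inv (e.symm σ), ?_⟩
  rw [← hσ]
  exact ConcreteCategory.congr_hom
    (PresheafedSpace.colimitPresheafObjIsoComponentwiseLimit_inv_ι_app F U .one) _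

/-- The forgetful functor to presheafed spaces preserves colimits, so the description of sections
carries over. -/
lemma sheafedSpace_coequalizer_π {X Y : SheafedSpace CommRingCat.{u}} (f g : X ⟶ Y) :
    ∃ e : coequalizer f.hom g.hom ≅ (coequalizer f g).toPresheafedSpace,
      (coequalizer.π f g).hom = coequalizer.π f.hom g.hom ≫ e.hom := by
  refine ⟨PreservesCoequalizer.iso SheafedSpace.forgetToPresheafedSpace f g, ?_⟩
  rw [PreservesCoequalizer.iso_hom]
  exact (ι_comp_coequalizerComparison f g SheafedSpace.forgetToPresheafedSpace).symm

lemma sheafedSpace_coequalizer_π_app_injective {X Y : SheafedSpace CommRingCat.{u}} (f g : X ⟶ Y)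
    (U : Opens (coequalizer f g).toPresheafedSpace) :
    Function.Injective ((coequalizer.π f g).hom.c.app (op U)) := by
  obtain ⟨e, he⟩ := sheafedSpace_coequalizer_π f g
  rw [he, PresheafedSpace.comp_c_app]
  have : IsIso e.hom.c := inferInstance
  exact (coequalizer_π_app_injective f.hom g.hom _).comp
    (ConcreteCategory.bijective_of_isIso (e.hom.c.app (op U))).1

lemma sheafedSpace_coequalizer_π_app_exists {X Y : SheafedSpace CommRingCat.{u}} (f g : X ⟶ Y)
    (U : Opens (coequalizer f g).toPresheafedSpace)
    (s : Y.presheaf.obj (op ((Opens.map (coequalizer.π f g).hom.base).obj U)))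
    (hs : ∀ (W : Opens X.toPresheafedSpace) (h₁ : W ≤ (Opens.map f.hom.base).obj
      ((Opens.map (coequalizer.π f g).hom.base).obj U)) (h₂ : W ≤ (Opens.map g.hom.base).obj
      ((Opens.map (coequalizer.π f g).hom.base).obj U)),
      X.presheaf.map (homOfLE h₁).op (f.hom.c.app _ s) =
        X.presheaf.map (homOfLE h₂).op (g.hom.c.app _ s)) :
    ∃ t, (coequalizer.π f g).hom.c.app (op U) t = s := by
  obtain ⟨e, he⟩ := sheafedSpace_coequalizer_π f g
  generalize (coequalizer.π f g).hom = q at *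
  subst he
  obtain ⟨t, ht⟩ := coequalizer_π_app_exists f.hom g.hom ((Opens.map e.hom.base).obj U) s hs
  have : IsIso e.hom.c := inferInstance
  obtain ⟨t, rfl⟩ := (ConcreteCategory.bijective_of_isIso (e.hom.c.app (op U))).2 t
  exact ⟨t, ht⟩

variable {D : Type u} [AddCommGroup D] [DecidableEq D] {S : Type u} [CommRing S]
  (𝒜 : D → AddSubgroup S) [GradedRing 𝒜]

lemma quotientMap_app_injective (V : Opens (Q 𝒜).toPresheafedSpace) :
    Function.Injective ((quotientMap 𝒜).hom.c.app (op V)) :=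
  sheafedSpace_coequalizer_π_app_injective _ _ V

lemma quotientMap_surjective : Function.Surjective (quotientMap 𝒜).hom.base :=
  (TopCat.epi_iff_surjective _).1 (inferInstanceAs (Epi (coequalizer.π
    (C := SheafedSpace CommRingCat.{u})
    (actionMap 𝒜).toLRSHom.toShHom (projectionMap D S).toLRSHom.toShHom).hom.base))

lemma quotientMap_condition :
    (actionMap 𝒜).toLRSHom.toShHom ≫ quotientMap 𝒜 =
      (projectionMap D S).toLRSHom.toShHom ≫ quotientMap 𝒜 :=
  coequalizer.condition _ _

/-- The quotient `Q(S)` as a locally ringed space. -/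
noncomputable def QL : LocallyRingedSpace.{u} :=
  LocallyRingedSpace.coequalizer (actionMap 𝒜).toLRSHom (projectionMap D S).toLRSHom

/-- The quotient map `Spec S → Q(S)` as a morphism of locally ringed spaces. -/
noncomputable def quotientMapL : (Spec (CommRingCat.of S)).toLocallyRingedSpace ⟶ QL 𝒜 :=
  (LocallyRingedSpace.coequalizerCofork (actionMap 𝒜).toLRSHom (projectionMap D S).toLRSHom).π

lemma quotientMapL_condition :
    (actionMap 𝒜).toLRSHom ≫ quotientMapL 𝒜 = (projectionMap D S).toLRSHom ≫ quotientMapL 𝒜 :=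
  (LocallyRingedSpace.coequalizerCofork (actionMap 𝒜).toLRSHom (projectionMap D S).toLRSHom).condition

end Sections

/-! ### Maps on sections followed by restriction -/

section AppLE

open Opposite

/-- The map on sections induced by a morphism of locally ringed spaces, for open subsets
`W ⊆ a⁻¹ U`. -/
noncomputable def appLE {X Y : LocallyRingedSpace.{u}} (a : X ⟶ Y) (U : Opens Y) (W : Opens X)
    (h : W ≤ (Opens.map a.base).obj U) : Y.presheaf.obj (op U) →+* X.presheaf.obj (op W) :=
  (a.c.app (op U) ≫ X.presheaf.map (homOfLE h).op).hom

lemma le_preimage_comp {X Y Z : LocallyRingedSpace.{u}} (a : X ⟶ Y) (b : Y ⟶ Z) {U : Opens Z}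
    {V : Opens Y} {W : Opens X} (h₁ : V ≤ (Opens.map b.base).obj U)
    (h₂ : W ≤ (Opens.map a.base).obj V) : W ≤ (Opens.map (a ≫ b).base).obj U :=
  fun _ hx => h₁ (h₂ hx)

lemma appLE_comp {X Y Z : LocallyRingedSpace.{u}} (a : X ⟶ Y) (b : Y ⟶ Z) (U : Opens Z)
    (V : Opens Y) (W : Opens X) (h₁ : V ≤ (Opens.map b.base).obj U)
    (h₂ : W ≤ (Opens.map a.base).obj V) (s : Z.presheaf.obj (op U)) :
    appLE a V W h₂ (appLE b U V h₁ s) =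
      appLE (a ≫ b) U W (le_preimage_comp a b h₁ h₂) s := by
  have h := ConcreteCategory.congr_hom (a.c.naturality (homOfLE h₁).op) (b.c.app (op U) s)
  refine (congrArg (X.presheaf.map (homOfLE h₂).op) h).trans ?_
  refine (ConcreteCategory.congr_hom (X.presheaf.map_comp ((Opens.map a.base).map (homOfLE h₁)).op
    (homOfLE h₂).op) _).symm

lemma appLE_congr {X Y : LocallyRingedSpace.{u}} {a b : X ⟶ Y} (hab : a = b) {U : Opens Y}
    {W : Opens X} (h : W ≤ (Opens.map a.base).obj U) (h' : W ≤ (Opens.map b.base).obj U)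
    (s : Y.presheaf.obj (op U)) : appLE a U W h s = appLE b U W h' s := by
  subst hab
  rfl

lemma appLE_preimage {X Y : LocallyRingedSpace.{u}} (a : X ⟶ Y) (U : Opens Y)
    (s : Y.presheaf.obj (op U)) : appLE a U ((Opens.map a.base).obj U) le_rfl s =
      a.c.app (op U) s :=
  ConcreteCategory.congr_hom (X.presheaf.map_id (op ((Opens.map a.base).obj U))) _

end AppLE

/-! ### Sections over principal opens of a spectrum -/

section SpecSections

open Opposite

/-- Elements of a ring as sections over an open subset of its spectrum. -/
noncomputable def toSection {R : Type u} [CommRing R] (U : (Spec (CommRingCat.of R)).Opens) :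
    R →+* (Spec (CommRingCat.of R)).presheaf.obj (op U) :=
  @algebraMap R _ _ _ (StructureSheaf.openAlgebra R (op U))

variable {R R' : Type u} [CommRing R] [CommRing R']

lemma map_toSection {U V : (Spec (CommRingCat.of R)).Opens} (i : op U ⟶ op V) (r : R) :
    (Spec (CommRingCat.of R)).presheaf.map i (toSection U r) = toSection V r := rfl

lemma app_toSection (φ : R →+* R') (U : (Spec (CommRingCat.of R)).Opens) (r : R) :
    (Spec.map (CommRingCat.ofHom φ)).app U (toSection U r) =
      toSection ((Spec.map (CommRingCat.ofHom φ)) ⁻¹ᵁ U) (φ r) := by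
  have h := ConcreteCategory.congr_hom (Scheme.ΓSpecIso_inv_naturality (CommRingCat.ofHom φ)) r
  have h1 : toSection ⊤ (φ r) = (Spec.map (CommRingCat.ofHom φ)).app ⊤ (toSection ⊤ r) := h
  rw [← map_toSection (homOfLE le_top).op r (U := ⊤) (V := U),
    ← map_toSection (homOfLE le_top).op (φ r) (U := ⊤), h1]
  exact ConcreteCategory.congr_hom ((Spec.map (CommRingCat.ofHom φ)).naturality
    (homOfLE (le_top (a := U))).op) _

lemma isLocalization_toSection (f : R) {U : (Spec (CommRingCat.of R)).Opens}
    (hU : U = PrimeSpectrum.basicOpen f) :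
    @IsLocalization.Away R _ f ((Spec (CommRingCat.of R)).presheaf.obj (op U)) _
      (StructureSheaf.openAlgebra R (op U)) := by
  subst hU
  exact StructureSheaf.IsLocalization.to_basicOpen R f

lemma isUnit_toSection (f : R) {U : (Spec (CommRingCat.of R)).Opens}
    (hU : U ≤ PrimeSpectrum.basicOpen f) : IsUnit (toSection U f) := by
  let _ : Algebra R ((Spec (CommRingCat.of R)).presheaf.obj (op (PrimeSpectrum.basicOpen f))) :=
    StructureSheaf.openAlgebra R (op (PrimeSpectrum.basicOpen f))
  have := isLocalization_toSection f (U := PrimeSpectrum.basicOpen f) rfl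
  have h : IsUnit (toSection (PrimeSpectrum.basicOpen f) f) :=
    IsLocalization.Away.algebraMap_isUnit (S := (Spec (CommRingCat.of R)).presheaf.obj
      (op (PrimeSpectrum.basicOpen f))) f
  exact h.map ((Spec (CommRingCat.of R)).presheaf.map (homOfLE hU).op).hom

lemma exists_mul_toSection (f : R) {U : (Spec (CommRingCat.of R)).Opens}
    (hU : U = PrimeSpectrum.basicOpen f) (s : (Spec (CommRingCat.of R)).presheaf.obj (op U)) :
    ∃ (n : ℕ) (b : R), s * toSection U f ^ n = toSection U b := by
  let _ : Algebra R ((Spec (CommRingCat.of R)).presheaf.obj (op U)) :=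
    StructureSheaf.openAlgebra R (op U)
  have := isLocalization_toSection f hU
  obtain ⟨n, b, h⟩ := IsLocalization.Away.surj f s
  exact ⟨n, b, h⟩

lemma exists_pow_mul_eq_of_toSection_eq (f : R) {U : (Spec (CommRingCat.of R)).Opens}
    (hU : U = PrimeSpectrum.basicOpen f) {a b : R} (h : toSection U a = toSection U b) :
    ∃ n : ℕ, f ^ n * a = f ^ n * b := by
  let _ : Algebra R ((Spec (CommRingCat.of R)).presheaf.obj (op U)) :=
    StructureSheaf.openAlgebra R (op U)
  have := isLocalization_toSection f hU
  exact IsLocalization.Away.exists_of_eq f h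

lemma appLE_toSection (φ : R →+* R') (U : (Spec (CommRingCat.of R)).Opens)
    (W : (Spec (CommRingCat.of R')).Opens)
    (h : W ≤ (Opens.map (Spec.map (CommRingCat.ofHom φ)).toLRSHom.base).obj U) (r : R) :
    appLE (Spec.map (CommRingCat.ofHom φ)).toLRSHom U W h (toSection U r) = toSection W (φ r) :=
  (congrArg ((Spec (CommRingCat.of R')).presheaf.map (homOfLE h).op) (app_toSection φ U r)).trans
    (map_toSection _ _)

/-- The extension of `toSection` to `R_f`, over an open subset of `D(f)`. -/
noncomputable def awayToSection (f : R) {U : (Spec (CommRingCat.of R)).Opens}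
    (hU : U ≤ PrimeSpectrum.basicOpen f) :
    Localization.Away f →+* (Spec (CommRingCat.of R)).presheaf.obj (op U) :=
  IsLocalization.Away.lift f (isUnit_toSection f hU)

lemma awayToSection_algebraMap (f : R) {U : (Spec (CommRingCat.of R)).Opens}
    (hU : U ≤ PrimeSpectrum.basicOpen f) (r : R) :
    awayToSection f hU (algebraMap R _ r) = toSection U r :=
  IsLocalization.Away.lift_eq f (isUnit_toSection f hU) r

lemma awayToSection_mk (f : R) {U : (Spec (CommRingCat.of R)).Opens}
    (hU : U ≤ PrimeSpectrum.basicOpen f) (a : R) (n : ℕ) :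
    awayToSection f hU (Localization.mk a (powersMk f n)) * toSection U f ^ n =
      toSection U a := by
  rw [← map_pow, ← awayToSection_algebraMap f hU, ← map_mul, ← awayToSection_algebraMap f hU,
    Localization.mk_eq_mk']
  congr 1
  exact IsLocalization.mk'_spec (Localization.Away f) a (powersMk f n)

lemma awayToSection_injective (f : R) {U : (Spec (CommRingCat.of R)).Opens}
    (hU : U = PrimeSpectrum.basicOpen f) : Function.Injective (awayToSection f hU.le) := by
  rw [injective_iff_map_eq_zero]
  intro y hy
  obtain ⟨⟨a, ⟨_, n, rfl⟩⟩, rfl⟩ := Localization.mkHom_surjective y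
  have h := awayToSection_mk f hU.le a n
  have h0 : awayToSection f hU.le (Localization.mk a (powersMk f n)) = 0 := hy
  rw [h0, zero_mul, ← map_zero (toSection U)] at h
  obtain ⟨k, hk⟩ := exists_pow_mul_eq_of_toSection_eq f hU h
  change Localization.mk a (powersMk f n) = 0
  rw [← Localization.mk_zero (powersMk f n), Localization.mk_eq_mk_iff, Localization.r_iff_exists]
  refine ⟨powersMk f k, ?_⟩
  linear_combination (-f ^ n) * hk

end SpecSections

/-! ### The structure sheaf of Q(S): invariant sections -/

section QuotientSections

open Opposite

variable {D : Type u} [AddCommGroup D] [DecidableEq D] {S : Type u} [CommRing S]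
  {𝒜 : D → AddSubgroup S} [GradedRing 𝒜]

lemma coeff_coaction (s : S) (d : D) :
    (coaction 𝒜 s).coeff d = (DirectSum.decompose 𝒜 s d : S) := by
  induction s using DirectSum.Decomposition.inductionOn 𝒜 with
  | zero => simp
  | homogeneous a =>
    rename_i i
    rw [coaction_of_mem 𝒜 a.2, AddMonoidAlgebra.coeff_single, DirectSum.decompose_coe,
      DirectSum.coe_of_apply, Finsupp.single_apply]
    split <;> rfl
  | add a b ha hb => simp [ha, hb]

lemma coaction_eq {d : D} {s : S} (hs : s ∈ 𝒜 d) : coaction 𝒜 s =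
    AddMonoidAlgebra.singleZeroRingHom s * AddMonoidAlgebra.single d 1 := by
  rw [coaction_of_mem 𝒜 hs]
  exact (by simp [AddMonoidAlgebra.single_mul_single] : AddMonoidAlgebra.single d s =
    AddMonoidAlgebra.single 0 s * AddMonoidAlgebra.single d 1)

omit [DecidableEq D] in
lemma isUnit_single (d : D) : IsUnit (AddMonoidAlgebra.single d (1 : S)) :=
  IsUnit.of_mul_eq_one (AddMonoidAlgebra.single (-d) 1)
    (by simp [AddMonoidAlgebra.single_mul_single, AddMonoidAlgebra.one_def])

/-- The preimage in `Spec S` of an open subset of `Q(S)`. -/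
noncomputable abbrev quotPreimage (V : Opens (QL 𝒜)) : (Spec (CommRingCat.of S)).Opens :=
  (Opens.map (quotientMapL 𝒜).base).obj V

lemma quotientMapL_app_injective (V : Opens (QL 𝒜)) (W : (Spec (CommRingCat.of S)).Opens)
    (hW : W = quotPreimage V) :
    Function.Injective (appLE (quotientMapL 𝒜) V W hW.le) := by
  subst hW
  intro s t h
  rw [appLE_preimage, appLE_preimage] at h
  -- The coequalizer of locally ringed spaces has, by construction, the coequalizer of sheafed
  -- spaces as underlying space.
  exact quotientMap_app_injective 𝒜 V h

lemma quotientMapL_app_exists (V : Opens (QL 𝒜)) (W : (Spec (CommRingCat.of S)).Opens)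
    (hW : W = quotPreimage V) (s : (Spec (CommRingCat.of S)).presheaf.obj (op W))
    (hs : ∀ (T : Opens (Spec (CommRingCat.of (AddMonoidAlgebra S D))).toLocallyRingedSpace)
      (h₁ : T ≤ (Opens.map (actionMap 𝒜).toLRSHom.base).obj W)
      (h₂ : T ≤ (Opens.map (projectionMap D S).toLRSHom.base).obj W),
      appLE (actionMap 𝒜).toLRSHom W T h₁ s = appLE (projectionMap D S).toLRSHom W T h₂ s) :
    ∃ t, appLE (quotientMapL 𝒜) V W hW.le t = s := by
  subst hW
  obtain ⟨t, ht⟩ := sheafedSpace_coequalizer_π_app_exists (actionMap 𝒜).toLRSHom.toShHom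
    (projectionMap D S).toLRSHom.toShHom V s hs
  exact ⟨t, (appLE_preimage _ _ _).trans ht⟩

lemma quotientMapL_app_invariant (V : Opens (QL 𝒜)) (W : (Spec (CommRingCat.of S)).Opens)
    (hW : W ≤ quotPreimage V) (t : (QL 𝒜).presheaf.obj (op V))
    (T : Opens (Spec (CommRingCat.of (AddMonoidAlgebra S D))).toLocallyRingedSpace)
    (h₁ : T ≤ (Opens.map (actionMap 𝒜).toLRSHom.base).obj W)
    (h₂ : T ≤ (Opens.map (projectionMap D S).toLRSHom.base).obj W) :
    appLE (actionMap 𝒜).toLRSHom W T h₁ (appLE (quotientMapL 𝒜) V W hW t) =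
      appLE (projectionMap D S).toLRSHom W T h₂ (appLE (quotientMapL 𝒜) V W hW t) := by
  rw [appLE_comp, appLE_comp]
  exact appLE_congr (quotientMapL_condition 𝒜) _ _ t

lemma appLE_action (W : (Spec (CommRingCat.of S)).Opens)
    (T : Opens (Spec (CommRingCat.of (AddMonoidAlgebra S D))).toLocallyRingedSpace)
    (h : T ≤ (Opens.map (actionMap 𝒜).toLRSHom.base).obj W) (s : S) :
    appLE (actionMap 𝒜).toLRSHom W T h (toSection W s) = toSection T (coaction 𝒜 s) :=
  appLE_toSection _ _ _ _ _

omit [DecidableEq D] in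
lemma appLE_projection (W : (Spec (CommRingCat.of S)).Opens)
    (T : Opens (Spec (CommRingCat.of (AddMonoidAlgebra S D))).toLocallyRingedSpace)
    (h : T ≤ (Opens.map (projectionMap D S).toLRSHom.base).obj W) (s : S) :
    appLE (projectionMap D S).toLRSHom W T h (toSection W s) =
      toSection T (AddMonoidAlgebra.singleZeroRingHom s) :=
  appLE_toSection _ _ _ _ _

variable {f : S} {m : D} {V : Opens (QL 𝒜)}

/-- For a fraction a / f^n of degree zero the coaction multiplies numerator and denominator by the
same monomial of degree n m, a unit that cancels; so the fraction is invariant and descends. -/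
lemma exists_section_of_away (hf : f ∈ 𝒜 m) {W : (Spec (CommRingCat.of S)).Opens}
    (hV : W = quotPreimage V) (hW : W = PrimeSpectrum.basicOpen f)
    (x : HomogeneousLocalization.Away 𝒜 f) :
    ∃ t : (QL 𝒜).presheaf.obj (op V), appLE (quotientMapL 𝒜) V W hV.le t =
      awayToSection f hW.le x.val := by
  obtain ⟨n, a, ha, rfl⟩ := HomogeneousLocalization.Away.mk_surjective 𝒜 hf x
  rw [HomogeneousLocalization.Away.val_mk]
  refine quotientMapL_app_exists V W hV _ fun T h₁ h₂ => ?_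
  have hs := awayToSection_mk f hW.le a n
  generalize awayToSection f hW.le (Localization.mk a (powersMk f n)) = s at hs
  have e₁ := congrArg (appLE (actionMap 𝒜).toLRSHom W T h₁) hs
  have e₂ := congrArg (appLE (projectionMap D S).toLRSHom W T h₂) hs
  rw [map_mul, map_pow, appLE_action, appLE_action, coaction_eq hf, coaction_eq ha, map_mul,
    map_mul] at e₁
  rw [map_mul, map_pow, appLE_projection, appLE_projection] at e₂
  have hu : IsUnit (toSection T (AddMonoidAlgebra.singleZeroRingHom f : AddMonoidAlgebra S D)) := by
    rw [← appLE_projection W T h₂]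
    exact (isUnit_toSection f hW.le).map _
  have hχ : (toSection T (AddMonoidAlgebra.single m 1 : AddMonoidAlgebra S D)) ^ n =
      toSection T (AddMonoidAlgebra.single (n • m) 1 : AddMonoidAlgebra S D) := by
    rw [← map_pow, AddMonoidAlgebra.single_pow, one_pow]
  rw [← hχ, ← e₂, mul_pow, ← mul_assoc] at e₁
  exact (hu.pow n).mul_right_cancel ((((isUnit_single m).map (toSection T)).pow n).mul_right_cancel e₁)

/-- Write the pullback of t as b / f^n. Invariance forces the coaction of b to equal b times the
monomial of degree n m, up to a power of f, so b may be replaced by its component in that degree. -/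
lemma exists_away_of_section (hf : f ∈ 𝒜 m) {W : (Spec (CommRingCat.of S)).Opens}
    (hV : W = quotPreimage V) (hW : W = PrimeSpectrum.basicOpen f)
    (t : (QL 𝒜).presheaf.obj (op V)) :
    ∃ x : HomogeneousLocalization.Away 𝒜 f, appLE (quotientMapL 𝒜) V W hV.le t =
      awayToSection f hW.le x.val := by
  let T : (Spec (CommRingCat.of (AddMonoidAlgebra S D))).Opens :=
    (Opens.map (projectionMap D S).toLRSHom.base).obj W
  have hT : T = PrimeSpectrum.basicOpen
      (AddMonoidAlgebra.singleZeroRingHom f : AddMonoidAlgebra S D) := by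
    subst hW; rfl
  have h₁ : T ≤ (Opens.map (actionMap 𝒜).toLRSHom.base).obj W := by
    subst hW
    exact (preimage_action_eq 𝒜 f ⟨m, hf⟩).ge
  have hinv := quotientMapL_app_invariant V W hV.le t T h₁ le_rfl
  obtain ⟨n, b, hs⟩ := exists_mul_toSection f hW (appLE (quotientMapL 𝒜) V W hV.le t)
  have e₁ := congrArg (appLE (actionMap 𝒜).toLRSHom W T h₁) hs
  have e₂ := congrArg (appLE (projectionMap D S).toLRSHom W T le_rfl) hs
  rw [map_mul, map_pow, appLE_action, appLE_action, coaction_eq hf, map_mul, hinv] at e₁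
  rw [map_mul, map_pow, appLE_projection, appLE_projection] at e₂
  have e₃ : toSection T (coaction 𝒜 b) = toSection T
      (AddMonoidAlgebra.singleZeroRingHom b * AddMonoidAlgebra.single (n • m) 1) := by
    rw [← e₁, map_mul, ← e₂, mul_pow, ← mul_assoc, ← map_pow (toSection T)
      (AddMonoidAlgebra.single m 1), AddMonoidAlgebra.single_pow, one_pow]
  obtain ⟨N, hN⟩ := exists_pow_mul_eq_of_toSection_eq _ hT e₃
  -- Coefficients at n m in S[D]: the coaction contributes the component of b, the other side all of
  -- b.
  have hb : f ^ N * (DirectSum.decompose 𝒜 b (n • m) : S) = f ^ N * b := by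
    have := congrArg (fun y : AddMonoidAlgebra S D => y.coeff (n • m)) hN
    rw [← map_pow, ← mul_assoc, ← map_mul] at this
    simp only [AddMonoidAlgebra.singleZeroRingHom_apply] at this
    erw [AddMonoidAlgebra.coeff_single_zero_mul, coeff_coaction] at this
    rw [this]
    erw [AddMonoidAlgebra.single_mul_single]
    simp
  refine ⟨HomogeneousLocalization.Away.mk 𝒜 hf n (DirectSum.decompose 𝒜 b (n • m))
    (SetLike.coe_mem _), ?_⟩
  have hu := isUnit_toSection f hW.le
  apply (hu.pow n).mul_right_cancel
  rw [hs, HomogeneousLocalization.Away.val_mk, awayToSection_mk]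
  apply (hu.pow N).mul_left_cancel
  rw [← map_pow, ← map_mul, ← map_mul, hb]

/-- If the preimage of `V ⊆ Q(S)` in `Spec S` is `D(f)`, the sections over `V` are `S_(f)`. -/
lemma exists_awayEquiv (hf : f ∈ 𝒜 m) {W : (Spec (CommRingCat.of S)).Opens}
    (hV : W = quotPreimage V) (hW : W = PrimeSpectrum.basicOpen f) :
    ∃ ρ : HomogeneousLocalization.Away 𝒜 f ≃+* (QL 𝒜).presheaf.obj (op V),
      ∀ x, appLE (quotientMapL 𝒜) V W hV.le (ρ x) = awayToSection f hW.le x.val := by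
  let α := appLE (quotientMapL 𝒜) V W hV.le
  have hα : Function.Injective α := quotientMapL_app_injective V W hV
  let β := (awayToSection f hW.le).comp
    (algebraMap (HomogeneousLocalization.Away 𝒜 f) (Localization.Away f))
  have hβ : Function.Injective β := (awayToSection_injective f hW).comp
    (HomogeneousLocalization.val_injective _)
  choose φ hφ using exists_section_of_away hf hV hW
  have hφ' : ∀ x, α (φ x) = β x := hφ
  let ρ : HomogeneousLocalization.Away 𝒜 f →+* (QL 𝒜).presheaf.obj (op V) :=
    { toFun := φ
      map_zero' := hα (by rw [hφ', map_zero, map_zero])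
      map_one' := hα (by rw [hφ', map_one, map_one])
      map_add' := fun x y => hα (by rw [hφ', map_add, map_add, hφ', hφ'])
      map_mul' := fun x y => hα (by rw [hφ', map_mul, map_mul, hφ', hφ']) }
  refine ⟨RingEquiv.ofBijective ρ ⟨fun x y h => hβ ?_, fun t => ?_⟩, hφ⟩
  · rw [← hφ', ← hφ']
    exact congrArg α h
  · obtain ⟨x, hx⟩ := exists_away_of_section hf hV hW t
    exact ⟨x, hα ((hφ' x).trans hx.symm)⟩

end QuotientSections

/-! ### The relevant locus of Q(S) as a topological space -/

section QuotientTopology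

variable {D : Type u} [AddCommGroup D] [DecidableEq D] {S : Type u} [CommRing S]
  (𝒜 : D → AddSubgroup S) [GradedRing 𝒜]

/-- The point of `Q(S)` defined by a prime ideal of `S`. -/
noncomputable def quot (P : PrimeSpectrum S) : Q 𝒜 := (quotientMap 𝒜).hom.base P

lemma quot_surjective : Function.Surjective (quot 𝒜) := quotientMap_surjective 𝒜

lemma quot_continuous : Continuous (quot 𝒜) := (quotientMap 𝒜).hom.base.hom.continuous

lemma quot_comap (z : PrimeSpectrum (AddMonoidAlgebra S D)) :
    quot 𝒜 (PrimeSpectrum.comap (coaction 𝒜) z) =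
      quot 𝒜 (PrimeSpectrum.comap AddMonoidAlgebra.singleZeroRingHom z) := by
  have h := congrArg (fun t => t.hom.base) (quotientMap_condition 𝒜)
  exact ConcreteCategory.congr_hom h z

variable {𝒜}

lemma preimage_imageBasicOpen {f : S} (hf : SetLike.IsHomogeneousElem 𝒜 f) :
    quot 𝒜 ⁻¹' imageBasicOpen 𝒜 f = {P | f ∉ P.asIdeal} := by
  have hc := Limits.isColimitCoforkMapOfIsColimit (SheafedSpace.forget CommRingCat.{u}) _
    (Limits.coequalizerIsCoequalizer (C := SheafedSpace CommRingCat.{u})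
      (actionMap 𝒜).toLRSHom.toShHom (projectionMap D S).toLRSHom.toShHom)
  fapply Limits.Types.coequalizer_preimage_image_eq_of_preimage_eq
    (↾(actionMap 𝒜).toLRSHom.base) (↾(projectionMap D S).toLRSHom.base)
    (↾(quotientMap 𝒜).hom.base)
  · ext z
    exact quot_comap 𝒜 z
  · exact Limits.isColimitCoforkMapOfIsColimit (CategoryTheory.forget TopCat) _ hc
  · exact congrArg (fun U : Opens _ => U.carrier) (preimage_action_eq 𝒜 f hf)

lemma quot_mem_imageBasicOpen {f : S} (hf : SetLike.IsHomogeneousElem 𝒜 f)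
    (P : PrimeSpectrum S) : quot 𝒜 P ∈ imageBasicOpen 𝒜 f ↔ f ∉ P.asIdeal :=
  Set.ext_iff.1 (preimage_imageBasicOpen hf) P

lemma mem_iff_of_quot_eq {P P' : PrimeSpectrum S} (h : quot 𝒜 P = quot 𝒜 P') {a : S}
    (ha : SetLike.IsHomogeneousElem 𝒜 a) : a ∈ P.asIdeal ↔ a ∈ P'.asIdeal := by
  rw [← not_iff_not, ← quot_mem_imageBasicOpen ha, ← quot_mem_imageBasicOpen ha, h]

lemma quot_eq {f : S} (hf : IsRelevant 𝒜 f) {P P' : PrimeSpectrum S} (hfP : f ∉ P.asIdeal)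
    (h : ∀ a, SetLike.IsHomogeneousElem 𝒜 a → (a ∈ P.asIdeal ↔ a ∈ P'.asIdeal)) :
    quot 𝒜 P = quot 𝒜 P' := by
  obtain ⟨z, hz, h₁, h₂⟩ := exists_orbit hf P.asIdeal P'.asIdeal h hfP
  have e₁ : PrimeSpectrum.comap (coaction 𝒜) ⟨z, hz⟩ = P' := PrimeSpectrum.ext h₁
  have e₂ : PrimeSpectrum.comap AddMonoidAlgebra.singleZeroRingHom ⟨z, hz⟩ = P :=
    PrimeSpectrum.ext h₂
  rw [← e₁, ← e₂, quot_comap]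

/-- The image in `Q(S)` of `D(f)` for `f` homogeneous, as an open subset. -/
noncomputable def imageOpen {f : S} (hf : SetLike.IsHomogeneousElem 𝒜 f) : Opens (QL 𝒜) :=
  ⟨imageBasicOpen 𝒜 f, isOpen_imageBasicOpen 𝒜 hf⟩

lemma quotPreimage_imageOpen {f : S} (hf : SetLike.IsHomogeneousElem 𝒜 f) :
    quotPreimage (imageOpen hf) = PrimeSpectrum.basicOpen f :=
  Opens.ext (preimage_imageBasicOpen hf)

variable {B : Ideal S}

lemma mem_relevantLocus {x : Q 𝒜} :
    x ∈ relevantLocus 𝒜 B ↔ ∃ f : Rel 𝒜 B, x ∈ imageBasicOpen 𝒜 f.1 := Set.mem_iUnion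

lemma quot_mem_relevantLocus {P : PrimeSpectrum S} :
    quot 𝒜 P ∈ relevantLocus 𝒜 B ↔ ∃ f : Rel 𝒜 B, f.1 ∉ P.asIdeal :=
  mem_relevantLocus.trans (exists_congr fun f => quot_mem_imageBasicOpen f.2.2.1 P)

/-- The map from the relevant locus of `Q(S)` to `Proj`, sending the class of a prime ideal to its
homogeneous core. -/
noncomputable def toProjD (x : relevantLocus 𝒜 B) : ProjD 𝒜 B :=
  corePoint 𝒜 B (Function.surjInv (quot_surjective 𝒜) x.1).asIdeal fun h => by
    obtain ⟨f, hf⟩ := quot_mem_relevantLocus.1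
      ((Function.surjInv_eq (quot_surjective 𝒜) x.1).symm ▸ x.2)
    exact hf (h f.2.1)

lemma mem_toProjD {x : relevantLocus 𝒜 B} {P : PrimeSpectrum S} (h : quot 𝒜 P = x.1) {a : S}
    (ha : SetLike.IsHomogeneousElem 𝒜 a) : a ∈ (toProjD x).1 ↔ a ∈ P.asIdeal :=
  (mem_core_iff 𝒜 ha).trans
    (mem_iff_of_quot_eq ((Function.surjInv_eq (quot_surjective 𝒜) x.1).trans h.symm) ha)

lemma toProjD_eq {x : relevantLocus 𝒜 B} {P : PrimeSpectrum S} (h : quot 𝒜 P = x.1) :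
    (toProjD x).1 = (P.asIdeal.homogeneousCore 𝒜).toIdeal :=
  ((toProjD x).2.1.core_eq
    (le_of_isHomogeneous 𝒜 (toProjD x).2.1.homogeneous fun _ ha => (mem_toProjD h ha).1)
    fun _ ha => (mem_toProjD h ha).2).symm

lemma toProjD_mem_basicOpen (x : relevantLocus 𝒜 B) {a : S} (ha : SetLike.IsHomogeneousElem 𝒜 a) :
    toProjD x ∈ basicOpen 𝒜 B a ↔ x.1 ∈ imageBasicOpen 𝒜 a := by
  obtain ⟨P, hP⟩ := quot_surjective 𝒜 x.1
  rw [← hP, quot_mem_imageBasicOpen ha]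
  exact not_congr (mem_toProjD hP ha)

lemma toProjD_injective : Function.Injective (toProjD (𝒜 := 𝒜) (B := B)) := by
  intro x y h
  obtain ⟨P, hP⟩ := quot_surjective 𝒜 x.1
  obtain ⟨P', hP'⟩ := quot_surjective 𝒜 y.1
  obtain ⟨f, hf⟩ := quot_mem_relevantLocus.1 (hP ▸ x.2)
  refine Subtype.ext (hP.symm.trans ((quot_eq f.2.2 hf fun a ha => ?_).trans hP'))
  rw [← mem_toProjD hP ha, h, mem_toProjD hP' ha]

lemma toProjD_continuous : Continuous (toProjD (𝒜 := 𝒜) (B := B)) := by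
  refine continuous_iff_isClosed.2 fun Z hZ => ?_
  obtain ⟨E, hE, rfl⟩ := isClosed_iff_zeroLocus.1 hZ
  have : toProjD ⁻¹' zeroLocus 𝒜 B E =
      ⋂ a : E, (Subtype.val ⁻¹' imageBasicOpen 𝒜 a.1 : Set (relevantLocus 𝒜 B))ᶜ := by
    ext x
    simp only [Set.mem_iInter, Set.mem_compl_iff, Set.mem_preimage, Subtype.forall]
    refine forall₂_congr fun a ha => ?_
    rw [← toProjD_mem_basicOpen x (hE a ha)]
    exact not_not.symm
  rw [this]
  exact isClosed_iInter fun a => (((isOpen_imageBasicOpen 𝒜 (hE a a.2)).preimage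
    continuous_subtype_val).isClosed_compl)

/-- Every point of `Proj` whose ideal is the core of a prime ideal comes from the relevant locus. -/
lemma exists_toProjD_eq (hB : IsConical 𝒜 B) (p : ProjD 𝒜 B) {P : PrimeSpectrum S}
    (h : (P.asIdeal.homogeneousCore 𝒜).toIdeal = p.1) :
    ∃ x : relevantLocus 𝒜 B, x.1 = quot 𝒜 P ∧ toProjD x = p := by
  obtain ⟨f, hf⟩ := exists_relevant_notMem hB p.2.1 p.2.2
  have hx : quot 𝒜 P ∈ relevantLocus 𝒜 B :=
    quot_mem_relevantLocus.2 ⟨f, fun h' => hf (h ▸ (mem_core_iff 𝒜 f.2.2.1).2 h')⟩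
  exact ⟨⟨_, hx⟩, rfl, Subtype.ext ((toProjD_eq rfl).trans h)⟩

lemma toProjD_surjective (hB : IsConical 𝒜 B) :
    Function.Surjective (toProjD (𝒜 := 𝒜) (B := B)) := by
  intro p
  obtain ⟨P, hP, -, h⟩ := p.2.1.exists_isPrime
  obtain ⟨x, -, hx⟩ := exists_toProjD_eq hB p (P := ⟨P, hP⟩) h
  exact ⟨x, hx⟩

/-- If V(I) is the preimage of C in Spec S, the image of C is cut out by the homogeneous elements of
I. For q containing these, a prime P containing I has core below q, but the point over q must be
shown to lie in C. -/
lemma toProjD_isClosedMap (hB : IsConical 𝒜 B) :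
    IsClosedMap (toProjD (𝒜 := 𝒜) (B := B)) := by
  intro C hC
  obtain ⟨C, hC', rfl⟩ := isClosed_induced_iff.1 hC
  obtain ⟨I, hI⟩ := (PrimeSpectrum.isClosed_iff_zeroLocus_ideal _).1
    (hC'.preimage (quot_continuous 𝒜))
  have hI' : ∀ P : PrimeSpectrum S, quot 𝒜 P ∈ C ↔ I ≤ P.asIdeal := fun P =>
    Set.ext_iff.1 hI P
  refine isClosed_iff_zeroLocus.2 ⟨{a | SetLike.IsHomogeneousElem 𝒜 a ∧ a ∈ I}, fun _ h => h.1, ?_⟩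
  ext q
  constructor
  · rintro ⟨x, hx, rfl⟩ a ⟨ha, haI⟩
    obtain ⟨P, hP⟩ := quot_surjective 𝒜 x.1
    exact (mem_toProjD hP ha).2 ((hI' P).1 (hP.symm ▸ hx) haI)
  · intro hq
    obtain ⟨P, hP, hIP, hPq⟩ := q.2.1.exists_isPrime_core_le fun a ha haI => hq ⟨ha, haI⟩
    let p : ProjD 𝒜 B := ⟨(P.homogeneousCore 𝒜).toIdeal, isDPrime_core 𝒜 P,
      fun h => q.2.2 (h.trans hPq)⟩
    -- Q' lies over q, and going down gives P' inside Q' with the core of P. Then P and P' have one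
    -- class, so I is contained in P' and hence in Q'.
    obtain ⟨Q', hQ', hqQ', hQ'q⟩ := q.2.1.exists_isPrime
    obtain ⟨P', hP', hP'Q', hP'p⟩ := p.2.1.exists_isPrime_le (hPq.trans hqQ')
    obtain ⟨x, hx, hxp⟩ := exists_toProjD_eq hB p (P := ⟨P, hP⟩) rfl
    obtain ⟨x', hx', hxp'⟩ := exists_toProjD_eq hB p (P := ⟨P', hP'⟩) hP'p
    obtain ⟨y, hy, hyq⟩ := exists_toProjD_eq hB q (P := ⟨Q', hQ'⟩) hQ'q
    obtain rfl := toProjD_injective (hxp.trans hxp'.symm)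
    refine ⟨y, ?_, hyq⟩
    have h1 : quot 𝒜 ⟨P', hP'⟩ ∈ C := hx' ▸ hx ▸ (hI' ⟨P, hP⟩).2 hIP
    change y.1 ∈ C
    rw [hy, hI']
    exact ((hI' ⟨P', hP'⟩).1 h1).trans hP'Q'

/-- The relevant locus of `Q(S)` is homeomorphic to the multihomogeneous `D`-prime spectrum. -/
noncomputable def projDHomeomorph (hB : IsConical 𝒜 B) : relevantLocus 𝒜 B ≃ₜ ProjD 𝒜 B :=
  (isHomeomorph_iff_continuous_isClosedMap_bijective.2 ⟨toProjD_continuous,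
    toProjD_isClosedMap hB, toProjD_injective, toProjD_surjective hB⟩).homeomorph

end QuotientTopology

/-! ### Morphisms to affine schemes -/

section SpecHom

open Opposite

/-- The adjunction between global sections and Spec, with its effect on sections recorded over
arbitrary opens. -/
lemma exists_hom_to_Spec {Z : LocallyRingedSpace.{u}} {R : Type u} [CommRing R]
    (γ : R →+* Z.presheaf.obj (op ⊤)) :
    ∃ h : Z ⟶ (Spec (CommRingCat.of R)).toLocallyRingedSpace,
      ∀ (U : (Spec (CommRingCat.of R)).Opens) (W : Opens Z) (hW : W ≤ (Opens.map h.base).obj U)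
        (r : R), appLE h U W hW (toSection U r) = Z.presheaf.map (homOfLE le_top).op (γ r) := by
  refine ⟨ΓSpec.locallyRingedSpaceAdjunction.homEquiv Z (op (CommRingCat.of R))
    (CommRingCat.ofHom γ).op, fun U W hW r => ?_⟩
  have h := ConcreteCategory.congr_hom
    (ΓSpec.toOpen_comp_locallyRingedSpaceAdjunction_homEquiv_app (X := Z) (R := R)
      (CommRingCat.ofHom γ).op (op U)) r
  refine (congrArg (Z.presheaf.map (homOfLE hW).op) h).trans ?_
  exact (ConcreteCategory.congr_hom (Z.presheaf.map_comp _ (homOfLE hW).op) (γ r)).symm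

lemma hom_to_Spec_ext {Z : LocallyRingedSpace.{u}} {R : Type u} [CommRing R]
    {a b : Z ⟶ (Spec (CommRingCat.of R)).toLocallyRingedSpace}
    (h : ∀ r, appLE a ⊤ ⊤ le_top (toSection ⊤ r) = appLE b ⊤ ⊤ le_top (toSection ⊤ r)) :
    a = b := by
  obtain ⟨a, rfl⟩ := (ΓSpec.locallyRingedSpaceAdjunction.homEquiv Z
    (op (CommRingCat.of R))).surjective a
  obtain ⟨b, rfl⟩ := (ΓSpec.locallyRingedSpaceAdjunction.homEquiv Z
    (op (CommRingCat.of R))).surjective b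
  congr 1
  apply Quiver.Hom.unop_inj
  ext r
  have key : ∀ (c : LocallyRingedSpace.Γ.rightOp.obj Z ⟶ op (CommRingCat.of R)),
      appLE (ΓSpec.locallyRingedSpaceAdjunction.homEquiv Z (op (CommRingCat.of R)) c) ⊤ ⊤ le_top
        (toSection ⊤ r) = c.unop r := fun c => by
    have h := ConcreteCategory.congr_hom
      (ΓSpec.toOpen_comp_locallyRingedSpaceAdjunction_homEquiv_app (X := Z) (R := R) c (op ⊤)) r
    refine (congrArg (Z.presheaf.map (homOfLE le_top).op) h).trans ?_
    refine (ConcreteCategory.congr_hom (Z.presheaf.map_comp _ (homOfLE le_top).op)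
      (c.unop r)).symm.trans ?_
    exact ConcreteCategory.congr_hom (Z.presheaf.map_id _) (c.unop r)
  exact (key a).symm.trans ((h r).trans (key b))

lemma appLE_bijective_of_isOpenImmersion {X Y : LocallyRingedSpace.{u}} (a : X ⟶ Y)
    [H : LocallyRingedSpace.IsOpenImmersion a] (U : Opens Y) (hU : (U : Set Y) ⊆ Set.range a.base)
    (W : Opens X) (hW : W = (Opens.map a.base).obj U) :
    Function.Bijective (appLE a U W hW.le) := by
  subst hW
  have : IsIso (a.c.app (op U)) := by
    refine PresheafedSpace.IsOpenImmersion.c_iso' a.toHom ((Opens.map a.base).obj U) ?_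
    refine Opens.ext ?_
    exact (Set.image_preimage_eq_iff.2 hU).symm
  have h : Function.Bijective (a.c.app (op U)) := ConcreteCategory.bijective_of_isIso _
  have e : ⇑(appLE a U ((Opens.map a.base).obj U) le_rfl) = ⇑(a.c.app (op U)) :=
    funext (appLE_preimage a U)
  exact e ▸ h

lemma appLE_awayToSection {R : Type u} [CommRing R] (f : R) {U : (Spec (CommRingCat.of R)).Opens}
    (hU : U ≤ PrimeSpectrum.basicOpen f)
    (W : (Spec (CommRingCat.of (Localization.Away f))).Opens)
    (h : W ≤ (Opens.map (Spec.map (CommRingCat.ofHom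
      (algebraMap R (Localization.Away f)))).toLRSHom.base).obj U) (y : Localization.Away f) :
    appLE (Spec.map (CommRingCat.ofHom (algebraMap R (Localization.Away f)))).toLRSHom U W h
      (awayToSection f hU y) = toSection W y := by
  have : (appLE (Spec.map (CommRingCat.ofHom (algebraMap R (Localization.Away f)))).toLRSHom U W
      h).comp (awayToSection f hU) = toSection W := by
    refine IsLocalization.ringHom_ext (Submonoid.powers f) (RingHom.ext fun r => ?_)
    refine (congrArg (appLE (Spec.map (CommRingCat.ofHom
      (algebraMap R (Localization.Away f)))).toLRSHom U W h)
        (awayToSection_algebraMap f hU r)).trans ?_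
    exact appLE_toSection _ _ _ _ _
  exact DFunLike.congr_fun this y

end SpecHom

/-! ### The morphism from the image of D(f) to Spec S_(f) -/

section Chart

open Opposite

variable {D : Type u} [AddCommGroup D] [DecidableEq D] {S : Type u} [CommRing S]
  {𝒜 : D → AddSubgroup S} [GradedRing 𝒜] {f : S}

/-- The open subspace of `Q(S)` that is the image of `D(f)`. -/
noncomputable abbrev chartSpace (hf : SetLike.IsHomogeneousElem 𝒜 f) : LocallyRingedSpace.{u} :=
  (QL 𝒜).restrict (imageOpen hf).isOpenEmbedding

/-- The inclusion of the image of `D(f)` into `Q(S)`. -/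
noncomputable abbrev chartInclusion (hf : SetLike.IsHomogeneousElem 𝒜 f) : chartSpace hf ⟶ QL 𝒜 :=
  (QL 𝒜).ofRestrict (imageOpen hf).isOpenEmbedding

variable (𝒜 f) in
/-- The composite `Spec S_f → Spec S → Q(S)`. -/
noncomputable def specToQL :
    (Spec (CommRingCat.of (Localization.Away f))).toLocallyRingedSpace ⟶ QL 𝒜 :=
  (Spec.map (CommRingCat.ofHom (algebraMap S (Localization.Away f)))).toLRSHom ≫ quotientMapL 𝒜

lemma range_specToQL : Set.range (specToQL 𝒜 f).base = imageBasicOpen 𝒜 f := by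
  have h := PrimeSpectrum.localization_away_comap_range (Localization.Away f) f
  ext x
  constructor
  · rintro ⟨q, rfl⟩
    exact ⟨_, h.le ⟨q, rfl⟩, rfl⟩
  · rintro ⟨P, hP, rfl⟩
    obtain ⟨q, rfl⟩ := h.ge hP
    exact ⟨q, rfl⟩

lemma range_chartInclusion (hf : SetLike.IsHomogeneousElem 𝒜 f) :
    Set.range (chartInclusion hf).base = imageBasicOpen 𝒜 f := Subtype.range_val

/-- The surjection from `Spec S_f` onto the image of `D(f)` in `Q(S)`. -/
noncomputable def chartCover (hf : SetLike.IsHomogeneousElem 𝒜 f) :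
    (Spec (CommRingCat.of (Localization.Away f))).toLocallyRingedSpace ⟶ chartSpace hf :=
  LocallyRingedSpace.IsOpenImmersion.lift (chartInclusion hf) (specToQL 𝒜 f)
    ((range_specToQL.trans (range_chartInclusion hf).symm).le)

lemma chartCover_comp (hf : SetLike.IsHomogeneousElem 𝒜 f) :
    chartCover hf ≫ chartInclusion hf = specToQL 𝒜 f :=
  LocallyRingedSpace.IsOpenImmersion.lift_fac _ _ _

lemma chartCover_base (hf : SetLike.IsHomogeneousElem 𝒜 f)
    (q : PrimeSpectrum (Localization.Away f)) : ((chartCover hf).base q).1 =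
      quot 𝒜 (PrimeSpectrum.comap (algebraMap S (Localization.Away f)) q) := by
  have h := congrArg (fun t => t.base) (chartCover_comp hf)
  exact ConcreteCategory.congr_hom h q

lemma chartCover_surjective (hf : SetLike.IsHomogeneousElem 𝒜 f) :
    Function.Surjective (chartCover hf).base := by
  intro y
  obtain ⟨q, hq⟩ := range_specToQL.ge y.2
  exact ⟨q, Subtype.ext ((chartCover_base hf q).trans hq)⟩

/-- The sections of the structure sheaf of `Q(S)` over the image of `D(f)`. -/
noncomputable def awaySections (hf : SetLike.IsHomogeneousElem 𝒜 f) :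
    HomogeneousLocalization.Away 𝒜 f ≃+* (QL 𝒜).presheaf.obj (op (imageOpen hf)) :=
  (exists_awayEquiv hf.choose_spec (quotPreimage_imageOpen hf).symm rfl).choose

lemma appLE_awaySections (hf : SetLike.IsHomogeneousElem 𝒜 f)
    (x : HomogeneousLocalization.Away 𝒜 f) :
    appLE (quotientMapL 𝒜) (imageOpen hf) (PrimeSpectrum.basicOpen f)
      (quotPreimage_imageOpen hf).ge (awaySections hf x) = awayToSection f le_rfl x.val :=
  (exists_awayEquiv hf.choose_spec (quotPreimage_imageOpen hf).symm rfl).choose_spec x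

lemma le_preimage_imageOpen (hf : SetLike.IsHomogeneousElem 𝒜 f) (W : Opens (chartSpace hf)) :
    W ≤ (Opens.map (chartInclusion hf).base).obj (imageOpen hf) := fun y _ => y.2

/-- The morphism from the image of `D(f)` in `Q(S)` to `Spec S_(f)`. -/
noncomputable def chartHom (hf : SetLike.IsHomogeneousElem 𝒜 f) :
    chartSpace hf ⟶ (specAway 𝒜 f).toLocallyRingedSpace :=
  (exists_hom_to_Spec ((appLE (chartInclusion hf) (imageOpen hf) ⊤
    (le_preimage_imageOpen hf ⊤)).comp (awaySections hf).toRingHom)).choose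

lemma appLE_chartHom (hf : SetLike.IsHomogeneousElem 𝒜 f) (U : (specAway 𝒜 f).Opens)
    (W : Opens (chartSpace hf)) (hW : W ≤ (Opens.map (chartHom hf).base).obj U)
    (x : HomogeneousLocalization.Away 𝒜 f) :
    appLE (chartHom hf) U W hW (toSection U x) =
      appLE (chartInclusion hf) (imageOpen hf) W (le_preimage_imageOpen hf W)
        (awaySections hf x) := by
  refine ((exists_hom_to_Spec ((appLE (chartInclusion hf) (imageOpen hf) ⊤
    (le_preimage_imageOpen hf ⊤)).comp (awaySections hf).toRingHom)).choose_spec U W hW x).trans ?_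
  exact (ConcreteCategory.congr_hom ((chartSpace hf).presheaf.map_comp
    (homOfLE (le_preimage_imageOpen hf ⊤)).op (homOfLE (le_top (a := W))).op) _).symm

/-- Since `chartCover` is surjective, this computes `chartHom` on points; the identity itself is
checked on global sections. -/
lemma chartCover_chartHom (hf : SetLike.IsHomogeneousElem 𝒜 f) :
    chartCover hf ≫ chartHom hf = (specToSpecAway 𝒜 f).toLRSHom := by
  have hle : (⊤ : (Spec (CommRingCat.of (Localization.Away f))).Opens) ≤
      (Opens.map (Spec.map (CommRingCat.ofHom
        (algebraMap S (Localization.Away f)))).toLRSHom.base).obj (PrimeSpectrum.basicOpen f) := by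
    intro q _
    exact (PrimeSpectrum.localization_away_comap_range (Localization.Away f) f).le ⟨q, rfl⟩
  refine hom_to_Spec_ext fun x => ?_
  refine (appLE_comp (chartCover hf) (chartHom hf) ⊤ ⊤ ⊤ le_top le_top _).symm.trans ?_
  refine (congrArg (appLE (chartCover hf) ⊤ ⊤ le_top) (appLE_chartHom hf ⊤ ⊤ le_top x)).trans ?_
  refine (appLE_comp (chartCover hf) (chartInclusion hf) _ ⊤ ⊤
    (le_preimage_imageOpen hf ⊤) le_top _).trans ?_
  refine (appLE_congr (chartCover_comp hf) _
    (le_preimage_comp _ _ (quotPreimage_imageOpen hf).ge hle) _).trans ?_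
  refine (appLE_comp _ (quotientMapL 𝒜) _ (PrimeSpectrum.basicOpen f) _
    (quotPreimage_imageOpen hf).ge hle _).symm.trans ?_
  refine (congrArg (appLE (Spec.map (CommRingCat.ofHom
    (algebraMap S (Localization.Away f)))).toLRSHom (PrimeSpectrum.basicOpen f) ⊤ hle)
      (appLE_awaySections hf x)).trans ?_
  refine (appLE_awayToSection f le_rfl ⊤ hle x.val).trans ?_
  exact (appLE_toSection (algebraMap (HomogeneousLocalization.Away 𝒜 f) (Localization.Away f))
    ⊤ ⊤ le_top x).symm

end Chart

/-! ### A criterion for isomorphisms onto a spectrum -/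

open Opposite

/-- A map of sheaves is an isomorphism if it is one on a basis; the forgetful functors to sheafed
and presheafed spaces reflect isomorphisms. -/
lemma isIso_of_isHomeomorph_of_bijective {X : LocallyRingedSpace.{u}} {R : Type u} [CommRing R]
    (a : X ⟶ (Spec (CommRingCat.of R)).toLocallyRingedSpace) (ha : IsHomeomorph a.base)
    (h : ∀ x : R, Function.Bijective (appLE a (PrimeSpectrum.basicOpen x) _ le_rfl)) :
    IsIso a := by
  let Y := (Spec (CommRingCat.of R)).toLocallyRingedSpace
  let φ : Y.sheaf ⟶ (TopCat.Sheaf.pushforward CommRingCat.{u} a.base).obj X.sheaf := ⟨a.c⟩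
  have hφ : IsIso φ := by
    refine TopCat.Sheaf.isIso_iff_isIso_basis (φ := φ)
      (B := fun x : R => (PrimeSpectrum.basicOpen x : Opens Y))
      PrimeSpectrum.isBasis_basic_opens fun x => ?_
    have e : ⇑(appLE a (PrimeSpectrum.basicOpen x)
        ((Opens.map a.base).obj (PrimeSpectrum.basicOpen x)) le_rfl) =
        ⇑(a.c.app (op (PrimeSpectrum.basicOpen x))) :=
      funext (appLE_preimage a _)
    have hx : Function.Bijective (a.c.app (op (PrimeSpectrum.basicOpen x))) := e ▸ h x
    exact (ConcreteCategory.isIso_iff_bijective _).2 hx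
  have hc : IsIso a.c := (inferInstance :
    IsIso ((TopCat.Sheaf.forget CommRingCat.{u} Y.toTopCat).map φ))
  have hb : IsIso a.base := (TopCat.isoOfHomeo (ha.homeomorph)).isIso_hom
  have hp := PresheafedSpace.isIso_of_components a.toHom
  have hs : IsIso (LocallyRingedSpace.forgetToSheafedSpace.map a) := by
    have : IsIso (SheafedSpace.forgetToPresheafedSpace.map
      (LocallyRingedSpace.forgetToSheafedSpace.map a)) := hp
    exact isIso_of_reflects_iso _ SheafedSpace.forgetToPresheafedSpace
  exact isIso_of_reflects_iso _ LocallyRingedSpace.forgetToSheafedSpace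

/-! ### The chart morphism is a homeomorphism -/

section Chart

variable {D : Type u} [AddCommGroup D] [DecidableEq D] {S : Type u} [CommRing S]
  {𝒜 : D → AddSubgroup S} [GradedRing 𝒜] {f : S}

lemma chartHom_base (hf : SetLike.IsHomogeneousElem 𝒜 f)
    (q : PrimeSpectrum (Localization.Away f)) : (chartHom hf).base ((chartCover hf).base q) =
      PrimeSpectrum.comap
        (algebraMap (HomogeneousLocalization.Away 𝒜 f) (Localization.Away f)) q := by
  have h := congrArg (fun t => t.base) (chartCover_chartHom hf)
  exact ConcreteCategory.congr_hom h q

lemma psi_toProjD {B : Ideal S} (f : Rel 𝒜 B) {x : relevantLocus 𝒜 B}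
    (hx : toProjD x ∈ basicOpen 𝒜 B f.1) (q : PrimeSpectrum (Localization.Away f.1))
    (h : quot 𝒜 (PrimeSpectrum.comap (algebraMap S (Localization.Away f.1)) q) = x.1) :
    psi 𝒜 f ⟨toProjD x, hx⟩ = PrimeSpectrum.comap
      (algebraMap (HomogeneousLocalization.Away 𝒜 f.1) (Localization.Away f.1)) q := by
  apply PrimeSpectrum.ext
  have h₁ := contraction_core f.2.2.1 q.asIdeal
  have h₂ := congrArg (contraction 𝒜 f.1) (toProjD_eq h)
  exact h₂.trans h₁

/-- On points the chart morphism is ψ_f composed with the restriction of `toProjD` to the image of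
D(f), both homeomorphisms. -/
lemma chartHom_isHomeomorph {B : Ideal S} (hB : IsConical 𝒜 B) (f : Rel 𝒜 B) :
    IsHomeomorph (chartHom f.2.2.1).base := by
  have hle : imageBasicOpen 𝒜 f.1 ⊆ (relevantLocus 𝒜 B : Set (Q 𝒜)) := fun x hx =>
    mem_relevantLocus.2 ⟨f, hx⟩
  let i : imageBasicOpen 𝒜 f.1 → relevantLocus 𝒜 B := Set.inclusion hle
  let r : imageBasicOpen 𝒜 f.1 → basicOpen 𝒜 B f.1 := fun y =>
    ⟨toProjD (i y), (toProjD_mem_basicOpen _ f.2.2.1).2 y.2⟩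
  have hr : Topology.IsEmbedding r := by
    refine Topology.IsEmbedding.of_comp_iff (Topology.IsEmbedding.subtypeVal) |>.1 ?_
    exact (projDHomeomorph hB).isEmbedding.comp (Topology.IsEmbedding.inclusion hle)
  have hr' : Function.Surjective r := by
    intro p
    obtain ⟨x, hx⟩ := toProjD_surjective hB p.1
    exact ⟨⟨x.1, (toProjD_mem_basicOpen x f.2.2.1).1 (hx ▸ p.2)⟩, Subtype.ext hx⟩
  have hr'' : IsHomeomorph r := by
    rw [isHomeomorph_iff_isEmbedding_surjective]
    exact ⟨hr, hr'⟩
  have heq : ⇑(chartHom f.2.2.1).base = psi 𝒜 f ∘ r := by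
    funext y
    obtain ⟨q, rfl⟩ := chartCover_surjective f.2.2.1 y
    exact (chartHom_base f.2.2.1 q).trans
      (psi_toProjD f (x := i ((chartCover f.2.2.1).base q)) (r _).2 q
        (chartCover_base f.2.2.1 q).symm).symm
  exact heq ▸ (psi_isHomeomorph f).comp hr''

end Chart

open Opposite

lemma appLE_map {X Y : LocallyRingedSpace.{u}} (a : X ⟶ Y) {U U' : Opens Y} {W : Opens X}
    (hU : U' ≤ U) (h : W ≤ (Opens.map a.base).obj U') (h' : W ≤ (Opens.map a.base).obj U)
    (s : Y.presheaf.obj (op U)) :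
    appLE a U' W h (Y.presheaf.map (homOfLE hU).op s) = appLE a U W h' s := by
  refine (congrArg (X.presheaf.map (homOfLE h).op)
    (ConcreteCategory.congr_hom (a.c.naturality (homOfLE hU).op) s)).trans ?_
  exact (ConcreteCategory.congr_hom (X.presheaf.map_comp
    ((Opens.map a.base).map (homOfLE hU)).op (homOfLE h).op) (a.c.app (op U) s)).symm

lemma map_appLE {X Y : LocallyRingedSpace.{u}} (a : X ⟶ Y) {U : Opens Y} {W W' : Opens X}
    (hW : W' ≤ W) (h : W ≤ (Opens.map a.base).obj U) (s : Y.presheaf.obj (op U)) :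
    X.presheaf.map (homOfLE hW).op (appLE a U W h s) = appLE a U W' (hW.trans h) s :=
  (ConcreteCategory.congr_hom (X.presheaf.map_comp (homOfLE h).op (homOfLE hW).op)
    (a.c.app (op U) s)).symm

lemma map_awayToSection {R : Type u} [CommRing R] (f : R) {U U' : (Spec (CommRingCat.of R)).Opens}
    (hU : U ≤ PrimeSpectrum.basicOpen f) (hU' : U' ≤ U) (y : Localization.Away f) :
    (Spec (CommRingCat.of R)).presheaf.map (homOfLE hU').op (awayToSection f hU y) =
      awayToSection f (hU'.trans hU) y := by
  have : ((Spec (CommRingCat.of R)).presheaf.map (homOfLE hU').op).hom.comp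
      (awayToSection f hU) = awayToSection f (hU'.trans hU) := by
    refine IsLocalization.ringHom_ext (Submonoid.powers f) (RingHom.ext fun r => ?_)
    refine (congrArg ((Spec (CommRingCat.of R)).presheaf.map (homOfLE hU').op)
      (awayToSection_algebraMap f hU r)).trans ?_
    exact (awayToSection_algebraMap f (hU'.trans hU) r).symm
  exact DFunLike.congr_fun this y

/-! ### The chart morphism is an isomorphism on sections -/

section ChartSections

variable {D : Type u} [AddCommGroup D] [DecidableEq D] {S : Type u} [CommRing S]
  {𝒜 : D → AddSubgroup S} [GradedRing 𝒜] {f : S}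

lemma val_away_mk_mul {m : D} (hm : f ∈ 𝒜 m) {n : ℕ} {a : S} (ha : a ∈ 𝒜 (n • m)) :
    (HomogeneousLocalization.Away.mk 𝒜 hm n a ha).val * algebraMap S (Localization.Away f) f ^ n =
      algebraMap S (Localization.Away f) a := by
  rw [HomogeneousLocalization.Away.val_mk, ← map_pow, Localization.mk_eq_mk']
  exact IsLocalization.mk'_spec (Localization.Away f) a (powersMk f n)

/-- In S_f the elements a / f^n and fa differ by a unit, so they vanish at the same primes. -/
lemma chartHom_preimage_basicOpen (hf : SetLike.IsHomogeneousElem 𝒜 f) {m : D} (hm : f ∈ 𝒜 m)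
    {n : ℕ} {a : S} (ha : a ∈ 𝒜 (n • m)) (hfa : SetLike.IsHomogeneousElem 𝒜 (f * a)) :
    (Opens.map (chartHom hf).base).obj
        (PrimeSpectrum.basicOpen (HomogeneousLocalization.Away.mk 𝒜 hm n a ha)) =
      (Opens.map (chartInclusion hf).base).obj (imageOpen hfa) := by
  ext y
  obtain ⟨q, rfl⟩ := chartCover_surjective hf y
  have h₁ := quot_mem_imageBasicOpen hfa
    (PrimeSpectrum.comap (algebraMap S (Localization.Away f)) q)
  have h₂ : (HomogeneousLocalization.Away.mk 𝒜 hm n a ha).val ∉ PrimeSpectrum.asIdeal q ↔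
      algebraMap S (Localization.Away f) (f * a) ∉ PrimeSpectrum.asIdeal q := by
    have hu := IsLocalization.Away.algebraMap_isUnit (S := Localization.Away f) f
    rw [map_mul, mul_comm, ← val_away_mk_mul hm ha, mul_assoc,
      Ideal.mul_unit_mem_iff_mem _ ((hu.pow n).mul hu)]
  have h₃ := congrArg (fun z : PrimeSpectrum _ =>
    HomogeneousLocalization.Away.mk 𝒜 hm n a ha ∉ z.asIdeal) (chartHom_base hf q)
  have h₄ := congrArg (· ∈ imageBasicOpen 𝒜 (f * a)) (chartCover_base hf q)
  exact (iff_of_eq h₃).trans (h₂.trans (h₁.symm.trans (iff_of_eq h₄.symm)))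

lemma imageOpen_mul_le (hf : SetLike.IsHomogeneousElem 𝒜 f) {a : S}
    (hfa : SetLike.IsHomogeneousElem 𝒜 (f * a)) : imageOpen hfa ≤ imageOpen hf := by
  rintro _ ⟨P, hP, rfl⟩
  exact ⟨P, fun h => hP (Ideal.mul_mem_right _ _ h), rfl⟩

/-- Sections over the part of the image of `D(f)` where `a` does not vanish embed into the
sections of the structure sheaf of `Spec S` over `D(f a)`. -/
lemma exists_chart_sections (hf : SetLike.IsHomogeneousElem 𝒜 f) {a : S}
    (hfa : SetLike.IsHomogeneousElem 𝒜 (f * a)) {W : Opens (chartSpace hf)}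
    (hW : W = (Opens.map (chartInclusion hf).base).obj (imageOpen hfa)) :
    ∃ δ : (chartSpace hf).presheaf.obj (op W) →+*
        (Spec (CommRingCat.of S)).presheaf.obj (op (PrimeSpectrum.basicOpen (f * a))),
      Function.Injective δ ∧
      (∀ r : HomogeneousLocalization.Away 𝒜 f,
        δ (appLE (chartInclusion hf) (imageOpen hf) W (le_preimage_imageOpen hf W)
          (awaySections hf r)) =
          awayToSection f (PrimeSpectrum.basicOpen_mul_le_left f a) r.val) ∧
      ∀ t, ∃ y : HomogeneousLocalization.Away 𝒜 (f * a),
        δ t = awayToSection (f * a) le_rfl y.val := by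
  have hle : (imageOpen hfa : Set (QL 𝒜)) ⊆ Set.range (chartInclusion hf).base := by
    rw [range_chartInclusion]
    exact imageOpen_mul_le hf hfa
  let ρ := RingEquiv.ofBijective (appLE (chartInclusion hf) (imageOpen hfa) W hW.le)
    (appLE_bijective_of_isOpenImmersion _ _ hle W hW)
  let α := appLE (quotientMapL 𝒜) (imageOpen hfa) (PrimeSpectrum.basicOpen (f * a))
    (quotPreimage_imageOpen hfa).ge
  refine ⟨α.comp ρ.symm.toRingHom, (quotientMapL_app_injective (imageOpen hfa) _
    (quotPreimage_imageOpen hfa).symm).comp ρ.symm.injective, fun r => ?_, fun t => ?_⟩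
  · have hi : ρ ((QL 𝒜).presheaf.map (homOfLE (imageOpen_mul_le hf hfa)).op (awaySections hf r)) =
        appLE (chartInclusion hf) (imageOpen hf) W (le_preimage_imageOpen hf W)
          (awaySections hf r) := appLE_map _ _ _ _ _
    refine (congrArg (fun t => α (ρ.symm t)) hi.symm).trans ?_
    refine (congrArg α (ρ.symm_apply_apply _)).trans ?_
    refine (appLE_map _ _ _ (((PrimeSpectrum.basicOpen_mul_le_left f a)).trans
      (quotPreimage_imageOpen hf).ge) _).trans ?_
    refine (map_appLE _ (PrimeSpectrum.basicOpen_mul_le_left f a)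
      (quotPreimage_imageOpen hf).ge _).symm.trans ?_
    refine (congrArg ((Spec (CommRingCat.of S)).presheaf.map
      (homOfLE (PrimeSpectrum.basicOpen_mul_le_left f a)).op) (appLE_awaySections hf r)).trans ?_
    exact map_awayToSection f le_rfl _ _
  · exact exists_away_of_section hfa.choose_spec (quotPreimage_imageOpen hfa).symm rfl (ρ.symm t)

/-- For x = a / f^n both rings of sections are S_(f) localized at x, that is S_(fa). Both are
compared inside the sections of Spec S over D(fa), through the injection δ. -/
lemma appLE_chartHom_bijective (hf : SetLike.IsHomogeneousElem 𝒜 f)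
    (x : HomogeneousLocalization.Away 𝒜 f) :
    Function.Bijective (appLE (chartHom hf) (PrimeSpectrum.basicOpen x) _ le_rfl) := by
  obtain ⟨m, hm⟩ := id hf
  obtain ⟨n, a, ha, rfl⟩ := HomogeneousLocalization.Away.mk_surjective 𝒜 hm x
  set x := HomogeneousLocalization.Away.mk 𝒜 hm n a ha
  have hfa : SetLike.IsHomogeneousElem 𝒜 (f * a) := ⟨_, SetLike.mul_mem_graded hm ha⟩
  let U : (specAway 𝒜 f).Opens := PrimeSpectrum.basicOpen x
  obtain ⟨δ, hδ, hδ₁, hδ₂⟩ := exists_chart_sections hf hfa (chartHom_preimage_basicOpen hf hm ha hfa)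
  let γ := appLE (chartHom hf) U _ le_rfl
  have hγ (r : HomogeneousLocalization.Away 𝒜 f) : δ (γ (toSection U r)) =
      awayToSection f (PrimeSpectrum.basicOpen_mul_le_left f a) r.val :=
    (congrArg δ (appLE_chartHom hf U _ le_rfl r)).trans (hδ₁ r)
  have hx : IsUnit (toSection U x) := isUnit_toSection x le_rfl
  let T : (Spec (CommRingCat.of S)).Opens := PrimeSpectrum.basicOpen (f * a)
  have hT : T ≤ PrimeSpectrum.basicOpen f := PrimeSpectrum.basicOpen_mul_le_left f a
  have hTf : IsUnit (toSection T f) := isUnit_toSection f hT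
  have hmk {k : ℕ} {c : S} (hc : c ∈ 𝒜 (k • m)) :
      δ (γ (toSection U (HomogeneousLocalization.Away.mk 𝒜 hm k c hc))) * toSection T f ^ k =
        toSection T c := by
    have e := congrArg (awayToSection f hT) (val_away_mk_mul hm hc)
    rw [map_mul, map_pow] at e
    exact (congrArg₂ (· * · ^ k) (hγ _) (awayToSection_algebraMap f hT f).symm).trans
      (e.trans (awayToSection_algebraMap f hT c))
  change Function.Bijective γ
  constructor
  · rw [injective_iff_map_eq_zero]
    intro s hs
    obtain ⟨k, r, hr⟩ := exists_mul_toSection x (U := U) rfl s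
    obtain ⟨j, c, hc, rfl⟩ := HomogeneousLocalization.Away.mk_surjective 𝒜 hm r
    have h₂ := hmk hc
    rw [← hr, map_mul, hs, zero_mul, map_zero, zero_mul, ← map_zero (toSection T)] at h₂
    obtain ⟨N, hN⟩ := exists_pow_mul_eq_of_toSection_eq (f * a) rfl h₂
    have hxa := val_away_mk_mul hm ha
    change x.val * _ = _ at hxa
    have h₃ : x ^ N * HomogeneousLocalization.Away.mk 𝒜 hm j c hc = 0 := by
      apply HomogeneousLocalization.val_injective
      have hu := IsLocalization.Away.algebraMap_isUnit (S := Localization.Away f) f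
      rw [HomogeneousLocalization.val_mul, HomogeneousLocalization.val_pow,
        HomogeneousLocalization.val_zero]
      refine (((hu.pow n).pow N).mul ((hu.pow N).mul (hu.pow j))).mul_left_eq_zero.1 ?_
      have h₄ := congrArg (algebraMap S (Localization.Away f)) hN
      rw [mul_zero, map_zero, map_mul, map_pow, map_mul, ← hxa, ← val_away_mk_mul hm hc] at h₄
      rw [h₄]
      ring
    have h₄ := congrArg (toSection U) h₃
    rw [map_mul, map_pow, map_zero] at h₄
    rw [(hx.pow N).mul_right_eq_zero.1 h₄] at hr
    exact (hx.pow k).mul_left_eq_zero.1 hr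
  · intro t
    obtain ⟨y, hy⟩ := hδ₂ t
    obtain ⟨N, b, hb, rfl⟩ := HomogeneousLocalization.Away.mk_surjective 𝒜
      (SetLike.mul_mem_graded hm ha) y
    -- As fa has degree m + n m, the product of b / (fa)^N with x^N is b / f^(N + N n), an element
    -- of S_(f).
    have hb' : b ∈ 𝒜 ((N + N * n) • m) := by
      convert hb using 2
      simp only [add_smul, smul_add, mul_smul]
    let r := HomogeneousLocalization.Away.mk 𝒜 hm (N + N * n) b hb'
    have h₁ : t * γ (toSection U x) ^ N = γ (toSection U r) := by
      apply hδ
      refine (hTf.pow (N + N * n)).mul_right_cancel ?_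
      have e := awayToSection_mk (f * a) (U := T) le_rfl b N
      have hxa : δ (γ (toSection U x)) * toSection T f ^ n = toSection T a := hmk ha
      replace hy : δ t = awayToSection (f * a) (U := T) le_rfl
          (Localization.mk b (powersMk (f * a) N)) :=
        hy.trans (congrArg _ (HomogeneousLocalization.Away.val_mk _ _ _ _ hb))
      rw [hmk hb', ← e, map_mul, map_mul, ← hxa, map_pow]
      refine (congrArg (· * _ * _) hy).trans ?_
      simp only [mul_pow, ← pow_mul, pow_add]
      ring
    obtain ⟨v, hv⟩ := hx.pow N
    refine ⟨toSection U r * ↑v⁻¹, ?_⟩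
    rw [map_mul, ← h₁, ← map_pow, mul_assoc, ← map_mul, ← hv, Units.mul_inv, map_one, mul_one]

lemma isIso_chartHom {B : Ideal S} (hB : IsConical 𝒜 B) (f : Rel 𝒜 B) :
    IsIso (chartHom f.2.2.1) :=
  isIso_of_isHomeomorph_of_bijective _ (chartHom_isHomeomorph hB f)
    (appLE_chartHom_bijective f.2.2.1)

end ChartSections

open Opposite

lemma isOpenImmersion_of_comp {X Y Z : LocallyRingedSpace.{u}} (f : X ⟶ Y) (g : Y ⟶ Z)
    [hg : LocallyRingedSpace.IsOpenImmersion g]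
    [hfg : LocallyRingedSpace.IsOpenImmersion (f ≫ g)] :
    LocallyRingedSpace.IsOpenImmersion f := by
  have h (x : X) : IsIso (f.stalkMap x) := by
    have h₁ : IsIso (g.stalkMap (f.base x) ≫ f.stalkMap x) := by
      rw [← LocallyRingedSpace.stalkMap_comp]
      exact LocallyRingedSpace.IsOpenImmersion.stalk_iso (f ≫ g) x
    exact IsIso.of_isIso_comp_left (g.stalkMap (f.base x)) (f.stalkMap x)
  exact LocallyRingedSpace.IsOpenImmersion.of_stalk_iso f
    (.of_comp _ hg.base_open hfg.base_open)

/-! ### The scheme structure on the relevant locus -/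

section ProjScheme

variable {D : Type u} [AddCommGroup D] [DecidableEq D] {S : Type u} [CommRing S]
  {𝒜 : D → AddSubgroup S} [GradedRing 𝒜] {B : Ideal S}

/-- The open immersion of `Spec S_(f)` into `Q(S)`. -/
noncomputable def awayToQL (hB : IsConical 𝒜 B) (f : Rel 𝒜 B) :
    (specAway 𝒜 f.1).toLocallyRingedSpace ⟶ QL 𝒜 :=
  have := isIso_chartHom hB f
  inv (chartHom f.2.2.1) ≫ chartInclusion f.2.2.1

instance (hB : IsConical 𝒜 B) (f : Rel 𝒜 B) :
    LocallyRingedSpace.IsOpenImmersion (awayToQL hB f) := by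
  have := isIso_chartHom hB f
  unfold awayToQL
  infer_instance

lemma specToSpecAway_awayToQL (hB : IsConical 𝒜 B) (f : Rel 𝒜 B) :
    (specToSpecAway 𝒜 f.1).toLRSHom ≫ awayToQL hB f = specToQL 𝒜 f.1 := by
  have := isIso_chartHom hB f
  rw [awayToQL, ← chartCover_chartHom f.2.2.1, Category.assoc, IsIso.hom_inv_id_assoc,
    chartCover_comp]

lemma specToSpecAway_surjective {f : S} (hf : SetLike.IsHomogeneousElem 𝒜 f)
    (y : PrimeSpectrum (HomogeneousLocalization.Away 𝒜 f)) :
    ∃ q, specToSpecAway 𝒜 f q = y := by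
  obtain ⟨Q, hQ, h⟩ := exists_isPrime_comap_away hf y.asIdeal
  exact ⟨⟨Q, hQ⟩, PrimeSpectrum.ext h⟩

lemma awayToQL_base (hB : IsConical 𝒜 B) (f : Rel 𝒜 B)
    (q : PrimeSpectrum (Localization.Away f.1)) :
    (awayToQL hB f).base (specToSpecAway 𝒜 f.1 q) =
      quot 𝒜 (PrimeSpectrum.comap (algebraMap S (Localization.Away f.1)) q) := by
  have h := congrArg (fun t => t.base) (specToSpecAway_awayToQL hB f)
  exact ConcreteCategory.congr_hom h q

lemma range_awayToQL (hB : IsConical 𝒜 B) (f : Rel 𝒜 B) :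
    Set.range (awayToQL hB f).base = imageBasicOpen 𝒜 f.1 := by
  rw [← range_specToQL]
  ext x
  constructor
  · rintro ⟨y, rfl⟩
    obtain ⟨q, rfl⟩ := specToSpecAway_surjective f.2.2.1 y
    exact ⟨q, (awayToQL_base hB f q).symm⟩
  · rintro ⟨q, rfl⟩
    exact ⟨_, awayToQL_base hB f q⟩

variable (𝒜 B) in
/-- The open subspace of `Q(S)` given by the relevant elements of `B`. -/
noncomputable abbrev relevantSpace : LocallyRingedSpace.{u} :=
  (QL 𝒜).restrict (relevantLocus 𝒜 B).isOpenEmbedding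

variable (𝒜 B) in
/-- The inclusion of the relevant locus into `Q(S)`. -/
noncomputable abbrev relevantInclusion : relevantSpace 𝒜 B ⟶ QL 𝒜 :=
  (QL 𝒜).ofRestrict (relevantLocus 𝒜 B).isOpenEmbedding

instance : LocallyRingedSpace.IsOpenImmersion (relevantInclusion 𝒜 B) :=
  LocallyRingedSpace.IsOpenImmersion.ofRestrict (QL 𝒜) (relevantLocus 𝒜 B).isOpenEmbedding

/-- The open immersion of `Spec S_(f)` into the relevant locus of `Q(S)`. -/
noncomputable def awayToRelevant (hB : IsConical 𝒜 B) (f : Rel 𝒜 B) :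
    (specAway 𝒜 f.1).toLocallyRingedSpace ⟶ relevantSpace 𝒜 B :=
  LocallyRingedSpace.IsOpenImmersion.lift (relevantInclusion 𝒜 B) (awayToQL hB f) (by
    rw [range_awayToQL]
    exact fun x hx => ⟨⟨x, mem_relevantLocus.2 ⟨f, hx⟩⟩, rfl⟩)

lemma awayToRelevant_comp (hB : IsConical 𝒜 B) (f : Rel 𝒜 B) :
    awayToRelevant hB f ≫ relevantInclusion 𝒜 B = awayToQL hB f :=
  LocallyRingedSpace.IsOpenImmersion.lift_fac _ _ _

instance isOpenImmersion_awayToRelevant (hB : IsConical 𝒜 B) (f : Rel 𝒜 B) :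
    LocallyRingedSpace.IsOpenImmersion (awayToRelevant hB f) := by
  have : LocallyRingedSpace.IsOpenImmersion (awayToRelevant hB f ≫ relevantInclusion 𝒜 B) := by
    rw [awayToRelevant_comp]
    infer_instance
  exact isOpenImmersion_of_comp _ (relevantInclusion 𝒜 B)

lemma awayToRelevant_base (hB : IsConical 𝒜 B) (f : Rel 𝒜 B) (y : specAway 𝒜 f.1) :
    ((awayToRelevant hB f).base y).1 = (awayToQL hB f).base y := by
  have h := congrArg (fun t => t.base) (awayToRelevant_comp hB f)
  exact ConcreteCategory.congr_hom h y

lemma mem_range_awayToRelevant (hB : IsConical 𝒜 B) (f : Rel 𝒜 B) (x : relevantLocus 𝒜 B) :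
    x ∈ Set.range (awayToRelevant hB f).base ↔ x.1 ∈ imageBasicOpen 𝒜 f.1 := by
  rw [← range_awayToQL hB f]
  constructor
  · rintro ⟨y, rfl⟩
    exact ⟨y, (awayToRelevant_base hB f y).symm⟩
  · rintro ⟨y, hy⟩
    exact ⟨y, Subtype.ext ((awayToRelevant_base hB f y).trans hy)⟩

/-- The scheme structure on the relevant locus of `Q(S)`. -/
noncomputable def projScheme (hB : IsConical 𝒜 B) : Scheme.{u} :=
  LocallyRingedSpace.IsOpenImmersion.scheme (relevantSpace 𝒜 B) fun x => by
    obtain ⟨f, hf⟩ := mem_relevantLocus.1 x.2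
    exact ⟨.of (HomogeneousLocalization.Away 𝒜 f.1), awayToRelevant hB f,
      (mem_range_awayToRelevant hB f x).2 hf, isOpenImmersion_awayToRelevant hB f⟩

/-- The open immersion of `Spec S_(f)` into the scheme on the relevant locus. -/
noncomputable def awayToProj (hB : IsConical 𝒜 B) (f : Rel 𝒜 B) :
    specAway 𝒜 f.1 ⟶ projScheme hB :=
  Scheme.Hom.mk (awayToRelevant hB f)

instance (hB : IsConical 𝒜 B) (f : Rel 𝒜 B) : IsOpenImmersion (awayToProj hB f) :=
  (inferInstance : LocallyRingedSpace.IsOpenImmersion (awayToRelevant hB f))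

/-- The underlying space of the scheme is the `D`-prime spectrum. -/
noncomputable def projHomeomorph (hB : IsConical 𝒜 B) : projScheme hB ≃ₜ ProjD 𝒜 B :=
  projDHomeomorph hB

lemma projHomeomorph_awayToProj (hB : IsConical 𝒜 B) (f : Rel 𝒜 B) (y : specAway 𝒜 f.1)
    (h : projHomeomorph hB (awayToProj hB f y) ∈ basicOpen 𝒜 B f.1) :
    psi 𝒜 f ⟨projHomeomorph hB (awayToProj hB f y), h⟩ = y := by
  obtain ⟨q, rfl⟩ := specToSpecAway_surjective f.2.2.1 y
  exact psi_toProjD f (x := (awayToRelevant hB f).base (specToSpecAway 𝒜 f.1 q)) h q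
    ((awayToRelevant_base hB f _).trans (awayToQL_base hB f q)).symm

lemma range_awayToProj (hB : IsConical 𝒜 B) (f : Rel 𝒜 B) :
    Set.range (awayToProj hB f) = chart 𝒜 (projHomeomorph hB) f := by
  ext x
  exact (mem_range_awayToRelevant hB f x).trans (toProjD_mem_basicOpen x f.2.2.1).symm

lemma specToSpecAway_awayToProj (hB : IsConical 𝒜 B) (f : Rel 𝒜 B) :
    (specToSpecAway 𝒜 f.1 ≫ awayToProj hB f).toLRSHom ≫ relevantInclusion 𝒜 B =
      specToQL 𝒜 f.1 := by
  refine Eq.trans ?_ (specToSpecAway_awayToQL hB f)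
  rw [← awayToRelevant_comp]
  exact Category.assoc _ _ _

/-- Used for the inclusion of the degree-zero part in the full localization: morphisms to an affine
scheme can be compared after pulling back to Spec S_f. -/
lemma specMap_comp_injective {R R' T : Type u} [CommRing R] [CommRing R'] [CommRing T]
    {φ : R →+* R'} (hφ : Function.Injective φ)
    {a b : Spec (CommRingCat.of R) ⟶ Spec (CommRingCat.of T)}
    (h : Spec.map (CommRingCat.ofHom φ) ≫ a = Spec.map (CommRingCat.ofHom φ) ≫ b) : a = b := by
  obtain ⟨a, rfl⟩ := Spec.map_surjective a
  obtain ⟨b, rfl⟩ := Spec.map_surjective b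
  rw [← Spec.map_comp, ← Spec.map_comp] at h
  congr 1
  ext t
  exact hφ (ConcreteCategory.congr_hom (Spec.map_injective h) t)

lemma exists_specAwayMap_fac {d : D} {f g h : S} (hg : g ∈ 𝒜 d) (hh : h = f * g) :
    ∃ τ : Localization.Away f →+* Localization.Away h,
      specToSpecAway 𝒜 h ≫ specAwayMap 𝒜 hg hh =
        Spec.map (CommRingCat.ofHom τ) ≫ specToSpecAway 𝒜 f ∧
      (Spec.map (CommRingCat.ofHom τ)).toLRSHom ≫ specToQL 𝒜 f = specToQL 𝒜 h := by
  have hu : IsUnit (algebraMap S (Localization.Away h) f) :=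
    isUnit_of_dvd_unit (map_dvd _ ⟨g, hh⟩) (IsLocalization.Away.algebraMap_isUnit h)
  refine ⟨Localization.awayLift (algebraMap S (Localization.Away h)) f hu, ?_, ?_⟩
  · rw [specToSpecAway, specToSpecAway, specAwayMap, ← Spec.map_comp, ← Spec.map_comp]
    congr 1
    ext x
    exact HomogeneousLocalization.val_awayMap 𝒜 hg hh x
  · have hτ : (Localization.awayLift (algebraMap S (Localization.Away h)) f hu).comp
        (algebraMap S (Localization.Away f)) = algebraMap S (Localization.Away h) :=
      by
      rw [Localization.awayLift, IsLocalization.Away.lift_comp]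
    have h₁ := Spec.map_comp (CommRingCat.ofHom (algebraMap S (Localization.Away f)))
      (CommRingCat.ofHom (Localization.awayLift (algebraMap S (Localization.Away h)) f hu))
    rw [← CommRingCat.ofHom_comp, hτ] at h₁
    rw [specToQL, specToQL, h₁]
    exact (Category.assoc _ _ _).symm

/-- The chart of h factors through that of f by some k, since their ranges are nested. Pulled back
to Spec S_h and pushed to `Q(S)`, k and the canonical map both give the composite Spec S_h → Spec S
→ Q(S), so they coincide. -/
lemma specAwayMap_awayToProj (hB : IsConical 𝒜 B) (f h : Rel 𝒜 B) {g : S} {d : D}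
    (hg : g ∈ 𝒜 d) (hh : h.1 = f.1 * g) :
    awayToProj hB h = specAwayMap 𝒜 hg hh ≫ awayToProj hB f := by
  have hle : Set.range (awayToProj hB h) ⊆ Set.range (awayToProj hB f) := by
    rw [range_awayToProj, range_awayToProj]
    intro x hx hx'
    exact hx (hh ▸ Ideal.mul_mem_right _ _ hx')
  obtain ⟨τ, e₁, e₂⟩ := exists_specAwayMap_fac hg hh
  obtain ⟨k, hk⟩ : ∃ k, k ≫ awayToProj hB f = awayToProj hB h :=
    ⟨_, IsOpenImmersion.lift_fac _ _ hle⟩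
  have e₃ : (specToSpecAway 𝒜 h.1 ≫ awayToProj hB h) =
      Spec.map (CommRingCat.ofHom τ) ≫ specToSpecAway 𝒜 f.1 ≫ awayToProj hB f := by
    apply Scheme.Hom.ext'
    refine (cancel_mono (relevantInclusion 𝒜 B)).1 ?_
    refine (specToSpecAway_awayToProj hB h).trans (e₂.symm.trans ?_)
    rw [← specToSpecAway_awayToProj hB f]
    exact (Category.assoc _ _ _).symm
  rw [← hk]
  congr 1
  refine specMap_comp_injective (φ := algebraMap (HomogeneousLocalization.Away 𝒜 h.1)
    (Localization.Away h.1)) (HomogeneousLocalization.val_injective _) ?_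
  change specToSpecAway 𝒜 h.1 ≫ k = specToSpecAway 𝒜 h.1 ≫ specAwayMap 𝒜 hg hh
  rw [← cancel_mono (awayToProj hB f), Category.assoc, hk, e₁, e₃, Category.assoc]

end ProjScheme

/-! ### The affine charts D_+(f) -/

section ProjCharts

variable {D : Type u} [AddCommGroup D] [DecidableEq D] {S : Type u} [CommRing S]
  {𝒜 : D → AddSubgroup S} [GradedRing 𝒜] {B : Ideal S}

/-- The isomorphism `D_+(f) ≅ Spec S_(f)`. -/
noncomputable def chartIso (hB : IsConical 𝒜 B) (f : Rel 𝒜 B) :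
    (chart 𝒜 (projHomeomorph hB) f).toScheme ≅ specAway 𝒜 f.1 :=
  IsOpenImmersion.isoOfRangeEq (chart 𝒜 (projHomeomorph hB) f).ι (awayToProj hB f)
    ((Scheme.Opens.range_ι _).trans (range_awayToProj hB f).symm)

lemma chartIso_inv_ι (hB : IsConical 𝒜 B) (f : Rel 𝒜 B) :
    (chartIso hB f).inv ≫ (chart 𝒜 (projHomeomorph hB) f).ι = awayToProj hB f :=
  IsOpenImmersion.isoOfRangeEq_inv_fac _ _ _

lemma isAffineOpen_chart (hB : IsConical 𝒜 B) (f : Rel 𝒜 B) :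
    IsAffineOpen (chart 𝒜 (projHomeomorph hB) f) := by
  have h : chart 𝒜 (projHomeomorph hB) f = (awayToProj hB f).opensRange :=
    Opens.ext (range_awayToProj hB f).symm
  rw [h]
  exact isAffineOpen_opensRange _

lemma chartIso_hom_apply (hB : IsConical 𝒜 B) (f : Rel 𝒜 B)
    (x : chart 𝒜 (projHomeomorph hB) f) :
    (chartIso hB f).hom x = psi 𝒜 f ⟨projHomeomorph hB x.1, x.2⟩ := by
  have h : awayToProj hB f ((chartIso hB f).hom x) = x.1 :=
    congrArg (fun t => t x) (IsOpenImmersion.isoOfRangeEq_hom_fac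
      (chart 𝒜 (projHomeomorph hB) f).ι (awayToProj hB f) _)
  have h' := projHomeomorph_awayToProj hB f ((chartIso hB f).hom x) (h.symm ▸ x.2)
  rw [← h']
  congr 2
  rw [h]

end ProjCharts

end MultigradedProj

theorem mainTheorem1 {D S : Type u} [AddCommGroup D] [DecidableEq D] [AddGroup.FG D]
    [CommRing S] [IsDomain S] (𝒜 : D → AddSubgroup S) [GradedRing 𝒜]
    (heff : MultigradedProj.IsEffective 𝒜) (hfact : MultigradedProj.IsFactoriallyGraded 𝒜)
    (B : Ideal S) (hB : MultigradedProj.IsConical 𝒜 B) :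
    -- the `D_+(f)` form an open covering and the `ψ_f` are homeomorphisms
    (∀ f : MultigradedProj.Rel 𝒜 B, IsOpen (MultigradedProj.basicOpen 𝒜 B f.1)) ∧
    (⋃ f : MultigradedProj.Rel 𝒜 B, MultigradedProj.basicOpen 𝒜 B f.1) = Set.univ ∧
    (∀ f : MultigradedProj.Rel 𝒜 B, IsHomeomorph (MultigradedProj.psi 𝒜 f)) ∧
    -- a scheme structure on `Proj_D^B(S)`, isomorphisms `D_+(f) ≅ Spec S_(f)` of schemes,
    -- and an isomorphism with the Brenner–Schröer `Proj^D_B(S)`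
    ∃ (X : AlgebraicGeometry.Scheme.{u}) (e : X ≃ₜ MultigradedProj.ProjD 𝒜 B)
      (φ : ∀ f : MultigradedProj.Rel 𝒜 B,
        (MultigradedProj.chart 𝒜 e f).toScheme ≅ MultigradedProj.specAway 𝒜 f.1)
      (θ : X.toSheafedSpace ≅ MultigradedProj.BSProj 𝒜 B),
      -- `D_+(f)` is affine and the map underlying the `f`-th isomorphism is `ψ_f`
      (∀ f : MultigradedProj.Rel 𝒜 B,
        AlgebraicGeometry.IsAffineOpen (MultigradedProj.chart 𝒜 e f)) ∧
      (∀ (f : MultigradedProj.Rel 𝒜 B) (x : MultigradedProj.chart 𝒜 e f),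
        (φ f).hom x = MultigradedProj.psi 𝒜 f ⟨e x.1, x.2⟩) ∧
      -- on overlaps the isomorphisms are compatible with the canonical maps `S_(f) → S_(fg)`
      (∀ (f h : MultigradedProj.Rel 𝒜 B) (g : S) (d : D) (hg : g ∈ 𝒜 d) (hh : h.1 = f.1 * g),
        (φ h).inv ≫ (MultigradedProj.chart 𝒜 e h).ι =
          MultigradedProj.specAwayMap 𝒜 hg hh ≫ (φ f).inv ≫
            (MultigradedProj.chart 𝒜 e f).ι) ∧
      -- the isomorphism `θ` is the canonical one: on `Spec S_f` it is induced by the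
      -- quotient morphism `Spec S → Q(S)`
      (∀ f : MultigradedProj.Rel 𝒜 B,
        (MultigradedProj.specToSpecAway 𝒜 f.1 ≫ (φ f).inv ≫
            (MultigradedProj.chart 𝒜 e f).ι).toLRSHom.toShHom ≫ θ.hom ≫
          MultigradedProj.BSProjInclusion 𝒜 B = MultigradedProj.specToQ 𝒜 f.1) := by
  open MultigradedProj in
  -- The sheafed space of the scheme is by definition the restriction of `Q(S)` to the relevant
  -- locus, so θ can be the identity.
  exact ⟨fun f => isOpen_basicOpen 𝒜 B f.2.2.1, iUnion_basicOpen hB, psi_isHomeomorph,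
    projScheme hB, projHomeomorph hB, chartIso hB, Iso.refl _, isAffineOpen_chart hB,
    chartIso_hom_apply hB, fun f h g d hg hh => by
      rw [chartIso_inv_ι, chartIso_inv_ι]
      exact specAwayMap_awayToProj hB f h hg hh, fun f => by
      rw [chartIso_inv_ι]
      exact congrArg LocallyRingedSpace.Hom.toShHom (specToSpecAway_awayToProj hB f)⟩
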